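/- Let $n$ be a dimension, $m\in\mathbb R$, $0\le\varrho\le 1$, $1\le p,q\le\infty$ and $0<r\le\infty$ with $\frac1r=\frac1p+\frac1q$. Write $\langle\xi\rangle=(1+|\xi|^2)^{1/2}$. A function $a:\mathbb R^n\times\mathbb R^n\to\mathbb C$ belongs to the class $L^pS^m_\varrho$ if $a(\cdot,\xi)$ is measurable for every $\xi$, $a(x,\cdot)\in C^\infty(\mathbb R^n)$ for almost every $x$, and for every multi-index $\alpha$ there is a constant $C_\alpha$ such that $$\|\partial_\xi^\alpha a(\cdot,\xi)\|_{L^p(\mathbb R^n)}\le C_\alpha\langle\xi\rangle^{m-\varrho|\alpha|}\qquad\text{for all }\xi\in\mathbb R^n.$$ For $a\in L^pS^m_\varrho$ and a Schwartz function $u$, let $$T_au(x)=\frac1{(2\pi)^n}\int_{\mathbb R^n}e^{i\langle x,\xi\rangle}a(x,\xi)\,\widehat u(\xi)\,d\xi,\qquad \widehat u(\xi)=\int_{\mathbb R^n}e^{-i\langle y,\xi\rangle}u(y)\,dy .$$ Let $s=\min(2,p,q)$ and suppose that $$m<\frac{n(\varrho-1)}{s}.$$ Then $T_a$ is bounded from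 $L^q$ to $L^r$ for every $a\in L^pS^m_\varrho$: for every Schwartz function $u$, the integral defining $T_au(x)$ converges absolutely for almost every $x$, $T_au$ is measurable, and $$\|T_au\|_{L^r(\mathbb R^n)}\le C\,\|u\|_{L^q(\mathbb R^n)},$$ where the constant $C$ depends only on $n,m,\varrho,p,q$ and on the constants $C_\alpha$ with $|\alpha|\le N$, for some $N$ depending only on $n,m,\varrho,p,q$. -/

import Mathlib

open MeasureTheory
open scoped NNReal ENNReal ContDiff SchwartzMap

noncomputable section

namespace RoughFIO

/-- The first order partial derivative `∂f/∂ξ_i` of a function on `ℝⁿ`. -/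
def partialDeriv {n : ℕ} (i : Fin n) (f : EuclideanSpace ℝ (Fin n) → ℂ) :
    EuclideanSpace ℝ (Fin n) → ℂ :=
  fun ξ => fderiv ℝ f ξ (EuclideanSpace.single i 1)

/-- The order `|α| = α_1 + ... + α_n` of a multi-index. -/
def order {n : ℕ} (α : Fin n → ℕ) : ℕ := ∑ i, α i

/-- The iterated partial derivative `∂^α f = ∂_1^{α_1} ⋯ ∂_n^{α_n} f`. -/
def multiDeriv {n : ℕ} (α : Fin n → ℕ) (f : EuclideanSpace ℝ (Fin n) → ℂ) :
    EuclideanSpace ℝ (Fin n) → ℂ :=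
  (List.finRange n).foldr (fun i g => (partialDeriv i)^[α i] g) f

/-- The bracket `⟨ξ⟩ = (1 + |ξ|²)^{1/2}`. -/
def bracket {n : ℕ} (ξ : EuclideanSpace ℝ (Fin n)) : ℝ := Real.sqrt (1 + ‖ξ‖ ^ 2)

/-- The estimate `‖∂_ξ^α a(·, ξ)‖_{L^p} ≤ C ⟨ξ⟩^{m - ϱ|α|}` for all `ξ`, with a given constant `C`
and a given multi-index `α`. -/
def DerivBound {n : ℕ} (p : ℝ≥0∞) (m ϱ : ℝ)
    (a : EuclideanSpace ℝ (Fin n) → EuclideanSpace ℝ (Fin n) → ℂ)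
    (α : Fin n → ℕ) (C : ℝ≥0) : Prop :=
  ∀ ξ : EuclideanSpace ℝ (Fin n),
    eLpNorm (fun x => multiDeriv α (a x) ξ) p volume
      ≤ (C : ℝ≥0∞) * ENNReal.ofReal (bracket ξ ^ (m - ϱ * (order α : ℝ)))

/-- The amplitude `a(x, ξ)` belongs to the class `L^p S^m_ϱ`. Measurability in `x` is Lebesgue
measurability, that is, almost everywhere equality with a Borel function. -/
structure IsAmplitude {n : ℕ} (p : ℝ≥0∞) (m ϱ : ℝ)
    (a : EuclideanSpace ℝ (Fin n) → EuclideanSpace ℝ (Fin n) → ℂ) : Prop where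
  measurable : ∀ ξ, AEStronglyMeasurable (fun x => a x ξ) volume
  smooth : ∀ᵐ x, ContDiff ℝ ∞ (a x)
  bound : ∀ α : Fin n → ℕ, ∃ C : ℝ≥0, DerivBound p m ϱ a α C

/-- The Fourier transform `û(ξ) = ∫ e^{-i⟨y,ξ⟩} u(y) dy`. -/
def fourierHat {n : ℕ} (u : EuclideanSpace ℝ (Fin n) → ℂ) (ξ : EuclideanSpace ℝ (Fin n)) : ℂ :=
  ∫ y, Complex.exp (-Complex.I * ((inner ℝ y ξ : ℝ) : ℂ)) * u y

/-- The integrand `e^{iφ(x,ξ)} a(x,ξ) û(ξ)` of a Fourier integral operator. -/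
def fioIntegrand {n : ℕ} (φ : EuclideanSpace ℝ (Fin n) → EuclideanSpace ℝ (Fin n) → ℝ)
    (a : EuclideanSpace ℝ (Fin n) → EuclideanSpace ℝ (Fin n) → ℂ)
    (u : EuclideanSpace ℝ (Fin n) → ℂ) (x ξ : EuclideanSpace ℝ (Fin n)) : ℂ :=
  Complex.exp (Complex.I * (φ x ξ : ℂ)) * a x ξ * fourierHat u ξ

/-- The Fourier integral operator with phase `φ` and amplitude `a`,
`T_a u(x) = (2π)^{-n} ∫ e^{iφ(x,ξ)} a(x,ξ) û(ξ) dξ`. -/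
def fio {n : ℕ} (φ : EuclideanSpace ℝ (Fin n) → EuclideanSpace ℝ (Fin n) → ℝ)
    (a : EuclideanSpace ℝ (Fin n) → EuclideanSpace ℝ (Fin n) → ℂ)
    (u : EuclideanSpace ℝ (Fin n) → ℂ) (x : EuclideanSpace ℝ (Fin n)) : ℂ :=
  (1 / (2 * (Real.pi : ℂ)) ^ n) * ∫ ξ, fioIntegrand φ a u x ξ

/-- The operator `T_a` is bounded from `L^q` to `L^r` with norm at most `K`: for every Schwartz
function `u` the integral defining `T_a u(x)` converges absolutely for almost every `x`, the
function `T_a u` is measurable, and `‖T_a u‖_{L^r} ≤ K ‖u‖_{L^q}`. -/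
def BoundedWithNorm {n : ℕ} (q r : ℝ≥0∞)
    (φ : EuclideanSpace ℝ (Fin n) → EuclideanSpace ℝ (Fin n) → ℝ)
    (a : EuclideanSpace ℝ (Fin n) → EuclideanSpace ℝ (Fin n) → ℂ) (K : ℝ≥0) : Prop :=
  ∀ u : 𝓢(EuclideanSpace ℝ (Fin n), ℂ),
    (∀ᵐ x, Integrable (fioIntegrand φ a u x) volume) ∧
    AEStronglyMeasurable (fio φ a u) volume ∧
    eLpNorm (fio φ a u) r volume ≤ (K : ℝ≥0∞) * eLpNorm u q volume

end RoughFIO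

end

/-! The symbol is cut by a Littlewood-Paley partition of unity into pieces `a(x,ξ) ψ_k(ξ)` living
where `⟨ξ⟩ ~ 2^k`. The `k`-th piece acts as `∫ K_k(x,z) u(x-z) dz`, where `K_k(x,·)` is the inverse
Fourier transform in `ξ` of that piece. With `t = 2^{kϱ}` and the weight `w(z) = 1 + ∑
(t|z_i|)^{n+1}`, Hölder's inequality in `z` bounds it pointwise by `A_k(x) B_k(x)`, where `A_k`
controls `‖w K_k(x,·)‖_{s'}` and `B_k(x) = ‖w⁻¹ u(x-·)‖_s`.

The three conditions in `s = min(2,p,q)` serve three purposes. Since `s ≤ 2`, Hausdorff-Young bounds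
`‖w K_k(x,·)‖_{s'}` by `L^s` norms in `ξ` of the piece and of `t^{n+1} ∂_i^{n+1}` of it
(`eLpNorm_weight_mul_oscInt_le`). Since `s ≤ p`, Minkowski's inequality lets the `L^p` norm in `x`
be taken first. Each `ξ`-derivative gains `2^{-kϱ}`, which `t` offsets, and the shell has volume of
order at most `2^{kn}`, so `‖A_k‖_p ≲ 2^{k(m+n/s)}` (`exists_eLpNorm_symbolNorm_le`). Since `s ≤ q`,
Minkowski again gives `‖B_k‖_q ≤ ‖w⁻¹‖_s ‖u‖_q ≲ 2^{-kϱn/s} ‖u‖_q` (`eLpNorm_convolution_weight_le`,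
`eLpNorm_inv_weight`).

The product of the two bounds is `2^{k(m-n(ϱ-1)/s)}` times `‖u‖_q`, and the hypothesis on `m` makes
this geometrically small. As `r` may be below `1`, the triangle inequality in `L^r` is avoided: the
sum of the `A_k B_k` is dominated pointwise by `(∑ α_k A_k)(∑ α_k⁻¹ B_k)`, the factors are summed in
`L^p` and `L^q`, and Hölder is applied once at the end. -/

noncomputable section

namespace RoughFIO

/-! ### Minkowski's inequality for integrals and mixed norms of nonnegative functions -/

section Minkowski

variable {X Y : Type*} [MeasurableSpace X] [MeasurableSpace Y] {μ : Measure X} {ν : Measure Y}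

theorem eLpNorm_eq_lintegral_rpow_of_ennreal {f : X → ℝ≥0∞} {p : ℝ≥0∞} (h0 : p ≠ 0)
    (ht : p ≠ ⊤) : eLpNorm f p μ = (∫⁻ x, f x ^ p.toReal ∂μ) ^ (1 / p.toReal) := by
  simp [eLpNorm_eq_lintegral_rpow_enorm_toReal h0 ht]

/-- Write `h^p = h · h^{p-1}`, bound the first factor by the integral of `F`, exchange the
integrals, use Hölder in `x` for each `y`, and divide by `I^{1-1/p}`. The division needs `I` finite,
so the argument is run for a minorant `h` of the inner integral, to be chosen as a truncation. -/
theorem lintegral_rpow_le_of_le_of_lintegral_finite [SFinite μ] [SFinite ν]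
    {F : X → Y → ℝ≥0∞} (hF : Measurable (Function.uncurry F)) {g : Y → ℝ≥0∞} {p : ℝ} (hp : 1 < p)
    (hg : ∀ᵐ y ∂ν, (∫⁻ x, F x y ^ p ∂μ) ^ (1 / p) ≤ g y)
    {h : X → ℝ≥0∞} (hh : Measurable h) (hhF : ∀ x, h x ≤ ∫⁻ y, F x y ∂ν)
    (hfin : ∫⁻ x, h x ^ p ∂μ ≠ ⊤) :
    (∫⁻ x, h x ^ p ∂μ) ^ (1 / p) ≤ ∫⁻ y, g y ∂ν := by
  set I := ∫⁻ x, h x ^ p ∂μ with hI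
  have hp0 : 0 < p := by linarith
  rcases eq_or_ne I 0 with h0 | h0
  · rw [h0, ENNReal.zero_rpow_of_pos (by positivity)]; exact zero_le
  have hpq : p.HolderConjugate (p / (p - 1)) := Real.HolderConjugate.conjExponent hp
  have key : I ≤ (∫⁻ y, g y ∂ν) * I ^ (1 - 1 / p) := by
    calc I ≤ ∫⁻ x, (∫⁻ y, F x y ∂ν) * h x ^ (p - 1) ∂μ := by
            refine lintegral_mono fun x => ?_
            calc h x ^ p = h x ^ (1 + (p - 1)) := by ring_nf
              _ = h x * h x ^ (p - 1) := by
                rw [ENNReal.rpow_add_of_nonneg _ _ zero_le_one (by linarith), ENNReal.rpow_one]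
              _ ≤ _ := by gcongr; exact hhF x
      _ = ∫⁻ x, ∫⁻ y, F x y * h x ^ (p - 1) ∂ν ∂μ := by
            refine lintegral_congr fun x => ?_
            rw [lintegral_mul_const]
            exact hF.comp measurable_prodMk_left
      _ = ∫⁻ y, ∫⁻ x, F x y * h x ^ (p - 1) ∂μ ∂ν := by
            rw [lintegral_lintegral_swap]
            exact (hF.mul ((hh.comp measurable_fst).pow_const _)).aemeasurable
      _ ≤ ∫⁻ y, g y * I ^ (1 - 1 / p) ∂ν := by
            refine lintegral_mono_ae ?_
            filter_upwards [hg] with y hy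
            calc _ ≤ (∫⁻ x, F x y ^ p ∂μ) ^ (1 / p) *
                  (∫⁻ x, (h x ^ (p - 1)) ^ (p / (p - 1)) ∂μ) ^ (1 / (p / (p - 1))) :=
                  ENNReal.lintegral_mul_le_Lp_mul_Lq μ hpq
                    (hF.comp measurable_prodMk_right).aemeasurable (hh.pow_const _).aemeasurable
              _ ≤ _ := by
                have e : ∀ x, (h x ^ (p - 1)) ^ (p / (p - 1)) = h x ^ p := fun x => by
                  rw [← ENNReal.rpow_mul, mul_div_cancel₀ _ (by linarith)]
                have e2 : 1 / (p / (p - 1)) = 1 - 1 / p := by field_simp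
                simp only [e, e2]
                gcongr
      _ = _ := by
            rw [lintegral_mul_const' _ _ (ENNReal.rpow_ne_top_of_nonneg _ hfin)]
            have : 1 / p ≤ 1 := by rw [div_le_one hp0]; exact hp.le
            linarith
  have hsplit : I = I ^ (1 / p) * I ^ (1 - 1 / p) := by
    rw [← ENNReal.rpow_add _ _ h0 hfin]; simp
  have hne0 : I ^ (1 - 1 / p) ≠ 0 := by
    simp [ENNReal.rpow_eq_zero_iff, h0, hfin]
  have hnet : I ^ (1 - 1 / p) ≠ ⊤ := by
    simp [ENNReal.rpow_eq_top_iff, h0, hfin]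
  rw [← ENNReal.mul_le_mul_iff_left hne0 hnet, ← hsplit]
  exact key

/-- Minkowski's integral inequality. -/
theorem eLpNorm_lintegral_le [SigmaFinite μ] [SFinite ν]
    {F : X → Y → ℝ≥0∞} (hF : Measurable (Function.uncurry F)) {g : Y → ℝ≥0∞} {p : ℝ≥0∞}
    (hp : 1 ≤ p) (hg : ∀ᵐ y ∂ν, eLpNorm (fun x => F x y) p μ ≤ g y) (hgm : Measurable g) :
    eLpNorm (fun x => ∫⁻ y, F x y ∂ν) p μ ≤ ∫⁻ y, g y ∂ν := by
  have hG : Measurable fun x => ∫⁻ y, F x y ∂ν := hF.lintegral_prod_right'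
  rcases eq_or_ne p ⊤ with rfl | ht
  · simp only [eLpNorm_exponent_top] at hg ⊢
    refine eLpNormEssSup_le_of_ae_enorm_bound ?_
    -- At the exponent `∞` the inequality amounts to exchanging two almost-everywhere quantifiers;
    -- measurability of `g` makes the exceptional set measurable.
    have h1 : ∀ᵐ y ∂ν, ∀ᵐ x ∂μ, F x y ≤ g y := by
      filter_upwards [hg] with y hy
      filter_upwards [enorm_ae_le_eLpNormEssSup (fun x => F x y) μ] with x hx
      exact le_trans hx hy
    have h2 : ∀ᵐ x ∂μ, ∀ᵐ y ∂ν, F x y ≤ g y := by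
      rw [Measure.ae_ae_comm]
      · exact h1
      · exact measurableSet_le hF (hgm.comp measurable_snd)
    filter_upwards [h2] with x hx
    exact lintegral_mono_ae hx
  rcases hp.eq_or_lt with rfl | hp1
  · simp only [eLpNorm_one_eq_lintegral_enorm, enorm_eq_self] at hg ⊢
    rw [lintegral_lintegral_swap hF.aemeasurable]
    exact lintegral_mono_ae hg
  have h0 : p ≠ 0 := (zero_lt_one.trans hp1).ne'
  have hr : 1 < p.toReal := by
    rw [← ENNReal.toReal_one]
    exact (ENNReal.toReal_lt_toReal ENNReal.one_ne_top ht).2 hp1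
  simp only [eLpNorm_eq_lintegral_rpow_of_ennreal h0 ht] at hg ⊢
  set r := p.toReal
  set G := fun x => ∫⁻ y, F x y ∂ν
  let S := spanningSets μ
  -- Cutting off both in height and to a set of finite measure makes the `r`-th power integrable;
  -- the truncations increase to `G`, and monotone convergence removes them.
  let h : ℕ → X → ℝ≥0∞ := fun n => (S n).indicator fun x => min (G x) n
  have hhm : ∀ n, Measurable (h n) := fun n =>
    (hG.min measurable_const).indicator (measurableSet_spanningSets μ n)
  have hmono : Monotone h := by
    intro a b hab x
    simp only [h]
    refine (Set.indicator_le_indicator_of_subset (monotone_spanningSets μ hab)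
      (fun _ => zero_le) x).trans ?_
    refine Set.indicator_le_indicator ?_
    gcongr
  have hsup : ∀ x, ⨆ n, h n x = G x := by
    intro x
    refine le_antisymm (iSup_le fun n => ?_) ?_
    · exact (Set.indicator_le_self _ _ x).trans (min_le_left _ _)
    · refine le_of_forall_lt fun c hc => ?_
      obtain ⟨m, hm⟩ := ENNReal.exists_nat_gt hc.ne_top
      obtain ⟨k, hk⟩ := Set.mem_iUnion.1 ((iUnion_spanningSets μ).symm ▸ Set.mem_univ x :
        x ∈ ⋃ n, S n)
      refine lt_of_lt_of_le ?_ (le_iSup (fun n => h n x) (max m k))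
      have : x ∈ S (max m k) := monotone_spanningSets μ (le_max_right _ _) hk
      simp only [h, Set.indicator_of_mem this]
      refine lt_min hc (hm.trans_le ?_)
      exact_mod_cast le_max_left _ _
  have hle : ∀ n, (∫⁻ x, h n x ^ r ∂μ) ^ (1 / r) ≤ ∫⁻ y, g y ∂ν := by
    intro n
    refine lintegral_rpow_le_of_le_of_lintegral_finite hF hr hg (hhm n)
      (fun x => (Set.indicator_le_self _ _ x).trans (min_le_left _ _)) ?_
    refine ne_top_of_le_ne_top (b := ∫⁻ x, (S n).indicator (fun _ => (n : ℝ≥0∞) ^ r) x ∂μ) ?_ ?_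
    · rw [lintegral_indicator_const (measurableSet_spanningSets μ n)]
      exact ENNReal.mul_ne_top (ENNReal.rpow_ne_top_of_nonneg (by linarith) (by simp))
        (measure_spanningSets_lt_top μ n).ne
    · refine lintegral_mono fun x => ?_
      by_cases hx : x ∈ S n
      · simp only [h, Set.indicator_of_mem hx]; gcongr; exact min_le_right _ _
      · simp only [h, Set.indicator_of_notMem hx]
        rw [ENNReal.zero_rpow_of_pos (by linarith)]
  have hr0 : 0 < r := by linarith
  rw [one_div, ENNReal.rpow_inv_le_iff hr0]
  have : ∫⁻ x, G x ^ r ∂μ = ⨆ n, ∫⁻ x, h n x ^ r ∂μ := by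
    rw [← lintegral_iSup (fun n => (hhm n).pow_const r)]
    · refine lintegral_congr fun x => ?_
      rw [← hsup x]
      exact (ENNReal.orderIsoRpow r hr0).map_iSup _
    · intro a b hab x
      exact ENNReal.rpow_le_rpow (hmono hab x) hr0.le
  rw [this]
  refine iSup_le fun n => ?_
  have := hle n
  rwa [one_div, ENNReal.rpow_inv_le_iff hr0] at this

/-- Minkowski's inequality for mixed norms. -/
theorem eLpNorm_eLpNorm_le [SigmaFinite μ] [SFinite ν]
    {F : X → Y → ℝ≥0∞} (hF : Measurable (Function.uncurry F)) {g : Y → ℝ≥0∞} {s p : ℝ≥0∞}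
    (hs1 : 1 ≤ s) (hst : s ≠ ⊤) (hp : s ≤ p)
    (hg : ∀ y, eLpNorm (fun x => F x y) p μ ≤ g y) (hgm : Measurable g) :
    eLpNorm (fun x => eLpNorm (F x) s ν) p μ ≤ eLpNorm g s ν := by
  have hs0 : s ≠ 0 := (zero_lt_one.trans_le hs1).ne'
  set t := s.toReal with ht
  have ht0 : 0 < t := ENNReal.toReal_pos hs0 hst
  have hts : ENNReal.ofReal t = s := ENNReal.ofReal_toReal hst
  have hexp : p / s * ENNReal.ofReal t = p := by
    rw [hts, ENNReal.div_mul_cancel hs0 hst]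
  -- Raising to the power `s` turns the inner norm into an integral, so the claim becomes the
  -- integral inequality with exponent `p / s ≥ 1`.
  have hpow : ∀ f : X → ℝ≥0∞, eLpNorm (fun x => f x ^ t) (p / s) μ = eLpNorm f p μ ^ t := by
    intro f
    have := eLpNorm_enorm_rpow (μ := μ) (p := p / s) f ht0
    rw [hexp] at this
    simpa using this
  have := eLpNorm_lintegral_le (μ := μ) (ν := ν) (F := fun x y => F x y ^ t)
    (g := fun y => g y ^ t) (p := p / s) (by exact hF.pow_const t)
    (by rwa [ENNReal.le_div_iff_mul_le (Or.inl hs0) (Or.inl hst), one_mul])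
    (Filter.Eventually.of_forall fun y => by
      rw [hpow fun x => F x y]
      exact ENNReal.rpow_le_rpow (hg y) ht0.le) (hgm.pow_const t)
  rw [eLpNorm_eq_lintegral_rpow_of_ennreal (f := g) hs0 hst, ← ht, one_div,
    ENNReal.le_rpow_inv_iff ht0, ← hpow]
  refine le_trans (le_of_eq ?_) this
  congr 1
  ext x
  rw [eLpNorm_eq_lintegral_rpow_of_ennreal hs0 hst, ← ht, one_div, ENNReal.rpow_inv_rpow ht0.ne']

theorem eLpNorm_tsum_ennreal_le [SigmaFinite μ] {F : ℕ → X → ℝ≥0∞} (hF : ∀ k, Measurable (F k))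
    {p : ℝ≥0∞} (hp : 1 ≤ p) :
    eLpNorm (fun x => ∑' k, F k x) p μ ≤ ∑' k, eLpNorm (F k) p μ := by
  have := eLpNorm_lintegral_le (μ := μ) (ν := Measure.count) (F := fun x k => F k x)
    (g := fun k => eLpNorm (F k) p μ) (p := p) (measurable_from_prod_countable_left hF)
    hp (by simp) (measurable_of_countable _)
  simpa [lintegral_count] using this

theorem ae_lt_top_of_eLpNorm_lt_top {f : X → ℝ≥0∞} (hf : Measurable f) {p : ℝ≥0∞} (hp : p ≠ 0)
    (h : eLpNorm f p μ < ⊤) : ∀ᵐ x ∂μ, f x < ⊤ := by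
  rcases eq_or_ne p ⊤ with rfl | ht
  · filter_upwards [enorm_ae_le_eLpNormEssSup f μ] with x hx
    exact lt_of_le_of_lt hx (by simpa using h)
  · have h0 := ENNReal.toReal_pos hp ht
    have := lintegral_rpow_enorm_lt_top_of_eLpNorm_lt_top hp ht h
    filter_upwards [ae_lt_top (hf.pow_const _) this.ne] with x hx
    simpa [ENNReal.rpow_lt_top_iff_of_pos h0] using hx

theorem measurable_eLpNorm_prod_right [SFinite ν] {F : X → Y → ℝ≥0∞}
    (hF : Measurable (Function.uncurry F)) {s : ℝ≥0∞} (h0 : s ≠ 0) (ht : s ≠ ⊤) :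
    Measurable fun x => eLpNorm (F x) s ν := by
  simp only [eLpNorm_eq_lintegral_rpow_of_ennreal h0 ht]
  exact (Measurable.lintegral_prod_right' (f := fun z : X × Y => F z.1 z.2 ^ s.toReal)
    (hF.pow_const _)).pow_const _

end Minkowski

/-! ### Plancherel's theorem for the unnormalized oscillatory integral -/

section Plancherel

open scoped FourierTransform

variable {n : ℕ}

local notation "E" => EuclideanSpace ℝ (Fin n)

/-- The unnormalized inverse Fourier transform `∫ e^{i⟨z,ξ⟩} f(ξ) dξ`. -/
def oscInt (f : EuclideanSpace ℝ (Fin n) → ℂ) (z : EuclideanSpace ℝ (Fin n)) : ℂ :=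
  ∫ ξ, Complex.exp (Complex.I * ((inner ℝ z ξ : ℝ) : ℂ)) * f ξ

theorem oscInt_eq_fourier (f : E → ℂ) (z : E) :
    oscInt f z = 𝓕 f ((-(2 * Real.pi)⁻¹ : ℝ) • z) := by
  rw [Real.fourier_eq', oscInt]
  refine integral_congr_ae (Filter.Eventually.of_forall fun ξ => ?_)
  simp only [smul_eq_mul, inner_smul_right, real_inner_comm]
  congr 2
  push_cast
  have : (Real.pi : ℂ) ≠ 0 := by exact_mod_cast Real.pi_ne_zero
  field_simp

theorem norm_exp_I_mul (t : ℝ) : ‖Complex.exp (Complex.I * (t : ℂ))‖ = 1 := by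
  rw [mul_comm]; exact Complex.norm_exp_ofReal_mul_I t

theorem enorm_exp_I_mul (t : ℝ) : ‖Complex.exp (Complex.I * (t : ℂ))‖ₑ = 1 := by
  rw [← ofReal_norm, norm_exp_I_mul, ENNReal.ofReal_one]

theorem enorm_oscInt_le (f : E → ℂ) (z : E) : ‖oscInt f z‖ₑ ≤ eLpNorm f 1 volume := by
  refine (enorm_integral_le_lintegral_enorm _).trans (le_of_eq ?_)
  rw [eLpNorm_one_eq_lintegral_enorm]
  simp [enorm_mul]

theorem integrable_exp_mul {f : E → ℂ} (hf : Integrable f) (z : E) :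
    Integrable fun ξ => Complex.exp (Complex.I * ((inner ℝ z ξ : ℝ) : ℂ)) * f ξ := by
  refine hf.bdd_mul (c := 1) (by fun_prop) (Filter.Eventually.of_forall fun ξ => ?_)
  rw [norm_exp_I_mul]

theorem oscInt_add {f g : E → ℂ} (hf : Integrable f) (hg : Integrable g) (z : E) :
    oscInt (f + g) z = oscInt f z + oscInt g z := by
  simp only [oscInt, Pi.add_apply, mul_add]
  exact integral_add (integrable_exp_mul hf z) (integrable_exp_mul hg z)

theorem continuous_oscInt {f : E → ℂ} (hf : Integrable f) : Continuous (oscInt f) := by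
  refine continuous_of_dominated (bound := fun ξ => ‖f ξ‖) ?_ ?_ hf.norm ?_
  · exact fun z => (integrable_exp_mul hf z).aestronglyMeasurable
  · intro z
    refine Filter.Eventually.of_forall fun ξ => ?_
    rw [norm_mul, norm_exp_I_mul, one_mul]
  · refine Filter.Eventually.of_forall fun ξ => ?_
    fun_prop

/-- Plancherel's theorem for the integral Fourier transform on `L¹ ∩ L²`. -/
theorem eLpNorm_fourier_eq {f : E → ℂ} (h1 : Integrable f) (h2 : MemLp f 2) :
    eLpNorm (𝓕 f) 2 volume = eLpNorm f 2 volume := by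
  set G : Lp (α := E) ℂ 2 volume := 𝓕 (h2.toLp f) with hG
  have hcont : Continuous (𝓕 f) := VectorFourier.fourierIntegral_continuous (μ := volume)
    Real.continuous_fourierChar (by exact continuous_inner) h1
  -- The integral transform and the `L²` transform are identified by testing against smooth
  -- compactly supported `g`: the multiplication formula gives both the pairing `∫ f · 𝓕 g`.
  have hae : ∀ᵐ x ∂volume, 𝓕 f x = G x := by
    refine ae_eq_of_integral_contDiff_smul_eq hcont.locallyIntegrable
      ((Lp.memLp G).locallyIntegrable (by norm_num)) fun g hg hgs => ?_
    have hgc : HasCompactSupport (Complex.ofRealCLM ∘ g) := hgs.comp_left rfl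
    let φ : 𝓢(E, ℂ) := hgc.toSchwartzMap (Complex.ofRealCLM.contDiff.comp hg)
    have e1 : ∫ x, g x • G x = ∫ x, φ x • G x := rfl
    have e2 : ∫ x, g x • 𝓕 f x = ∫ x, 𝓕 f x • φ x := by
      refine integral_congr_ae (Filter.Eventually.of_forall fun x => ?_)
      simp [φ, mul_comm]
    have e3 : ∫ x, 𝓕 f x • φ x = ∫ x, f x • 𝓕 (φ : E → ℂ) x := by
      have := VectorFourier.integral_fourierIntegral_smul_eq_flip (μ := volume) (ν := volume)
        (L := innerₗ E) (f := f) (g := φ) Real.continuous_fourierChar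
        (by exact continuous_inner) h1 φ.integrable
      rwa [flip_innerₗ] at this
    rw [e1, e2, e3, ← Lp.toTemperedDistribution_apply, hG,
      ← Lp.fourier_toTemperedDistribution_eq, TemperedDistribution.fourier_apply,
      Lp.toTemperedDistribution_apply]
    refine integral_congr_ae ?_
    filter_upwards [h2.coeFn_toLp] with x hx
    rw [hx, SchwartzMap.fourier_coe, smul_eq_mul, smul_eq_mul, mul_comm]
  rw [eLpNorm_congr_ae hae, ← eLpNorm_congr_ae h2.coeFn_toLp]
  have := Lp.norm_fourier_eq (h2.toLp f)
  rw [Lp.norm_def, Lp.norm_def] at this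
  exact (ENNReal.toReal_eq_toReal_iff' (Lp.eLpNorm_ne_top _) (Lp.eLpNorm_ne_top _)).1 this

theorem exists_eLpNorm_oscInt_two_le (n : ℕ) : ∃ C : ℝ≥0, ∀ f : EuclideanSpace ℝ (Fin n) → ℂ,
    Integrable f → MemLp f 2 → eLpNorm (oscInt f) 2 volume ≤ C * eLpNorm f 2 volume := by
  set c : ℝ := -(2 * Real.pi)⁻¹ with hc
  have hc0 : c ≠ 0 := by simp [hc, Real.pi_ne_zero]
  -- The constant is the square root of the Jacobian factor of the dilation by `c` relating the two
  -- normalizations.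
  refine ⟨(Real.toNNReal |(c ^ n)⁻¹|) ^ (1 / 2 : ℝ), fun f h1 h2 => ?_⟩
  have hcont : Continuous (𝓕 f) := VectorFourier.fourierIntegral_continuous (μ := volume)
    Real.continuous_fourierChar (by exact continuous_inner) h1
  have e : oscInt f = 𝓕 f ∘ (c • ·) := funext fun z => oscInt_eq_fourier f z
  rw [e, ← eLpNorm_map_measure (by exact hcont.aestronglyMeasurable) (by fun_prop),
    Measure.map_addHaar_smul _ hc0, eLpNorm_smul_measure_of_ne_top (by norm_num),
    eLpNorm_fourier_eq h1 h2, smul_eq_mul]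
  refine le_of_eq ?_
  congr 1
  simp only [finrank_euclideanSpace, Fintype.card_fin]
  rw [ENNReal.coe_rpow_of_nonneg _ (by positivity)]
  simp [ENNReal.ofReal]

end Plancherel

/-! ### The Hausdorff-Young inequality by real interpolation -/

section HausdorffYoung

variable {n : ℕ}

local notation "E" => EuclideanSpace ℝ (Fin n)

/-- The weak type estimate behind the Hausdorff-Young inequality: `f` is split at a height
depending on `t`. -/
theorem measure_lt_norm_oscInt_le {C : ℝ≥0} (hC : ∀ f : EuclideanSpace ℝ (Fin n) → ℂ,
    Integrable f → MemLp f 2 → eLpNorm (oscInt f) 2 volume ≤ C * eLpNorm f 2 volume)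
    {f : E → ℂ} (hf : Continuous f) (hfs : HasCompactSupport f) {s : ℝ} (hs : 1 < s)
    {M : ℝ} (hM : 0 < M) (hMf : ∫ ξ, ‖f ξ‖ ^ s = M) {t : ℝ} (ht : 0 < t) :
    volume {z | t < ‖oscInt f z‖} * ENNReal.ofReal (t ^ 2) ≤
      4 * C ^ 2 * ∫⁻ ξ, {ξ | t * ‖f ξ‖ ^ (s - 1) ≤ 2 * M}.indicator (fun ξ => ‖f ξ‖ₑ ^ 2) ξ := by
  set S : Set E := {ξ | t * ‖f ξ‖ ^ (s - 1) ≤ 2 * M} with hS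
  have hcs : Continuous fun ξ => ‖f ξ‖ ^ s := hf.norm.rpow_const fun _ => Or.inr (by linarith)
  have hSm : MeasurableSet S := by
    refine (isClosed_le ?_ continuous_const).measurableSet
    exact continuous_const.mul (hf.norm.rpow_const fun _ => Or.inr (by linarith))
  have hfi : Integrable f := hf.integrable_of_hasCompactSupport hfs
  have hfis : Integrable fun ξ => ‖f ξ‖ ^ s := by
    refine hcs.integrable_of_hasCompactSupport (hfs.comp_left (g := fun w : ℂ => ‖w‖ ^ s) ?_)
    simp [Real.zero_rpow (by linarith : s ≠ 0)]
  have hf2 : MemLp f 2 := hf.memLp_of_hasCompactSupport hfs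
  -- Off `S` the height of `f` forces `|f| ≤ t |f|^s / (2M)`, so this part has `L¹` norm at most `t
  -- / 2`. Thus only the part on `S` can push the transform above `t`, and it is handled by
  -- Chebyshev and Plancherel.
  have h1 : ∀ z, ‖oscInt (Sᶜ.indicator f) z‖ ≤ t / 2 := by
    intro z
    have hb : ∀ ξ, ‖Sᶜ.indicator f ξ‖ ≤ t / (2 * M) * ‖f ξ‖ ^ s := by
      intro ξ
      by_cases hξ : ξ ∈ S
      · rw [Set.indicator_of_notMem (by simpa using hξ), norm_zero]; positivity
      · rw [Set.indicator_of_mem (by simpa using hξ)]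
        have h2 : 2 * M < t * ‖f ξ‖ ^ (s - 1) := not_le.1 hξ
        have h3 : ‖f ξ‖ ^ s = ‖f ξ‖ * ‖f ξ‖ ^ (s - 1) := by
          rcases (norm_nonneg (f ξ)).eq_or_lt with h0 | h0
          · rw [← h0, Real.zero_rpow (by linarith), zero_mul]
          · rw [← Real.rpow_one_add' h0.le (by linarith)]; ring_nf
        rw [h3, div_mul_eq_mul_div, le_div_iff₀ (by positivity)]
        nlinarith [norm_nonneg (f ξ)]
    calc ‖oscInt (Sᶜ.indicator f) z‖ ≤ ∫ ξ, t / (2 * M) * ‖f ξ‖ ^ s := by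
          refine norm_integral_le_of_norm_le (hfis.const_mul _) ?_
          refine Filter.Eventually.of_forall fun ξ => ?_
          rw [norm_mul, norm_exp_I_mul, one_mul]
          exact hb ξ
      _ = t / 2 := by rw [integral_const_mul, hMf]; field_simp
  have hsub : {z | t < ‖oscInt f z‖} ⊆ {z | ENNReal.ofReal (t / 2) ≤ ‖oscInt (S.indicator f) z‖ₑ} := by
    intro z hz
    have e : oscInt f z = oscInt (S.indicator f) z + oscInt (Sᶜ.indicator f) z := by
      rw [← oscInt_add (hfi.indicator hSm) (hfi.indicator hSm.compl), Set.indicator_self_add_compl]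
    have h3 : t < ‖oscInt f z‖ := hz
    have h4 := norm_add_le (oscInt (S.indicator f) z) (oscInt (Sᶜ.indicator f) z)
    rw [← e] at h4
    change ENNReal.ofReal (t / 2) ≤ ‖oscInt (S.indicator f) z‖ₑ
    rw [← ofReal_norm]
    refine ENNReal.ofReal_le_ofReal ?_
    linarith [h1 z]
  have hcheb := mul_meas_ge_le_pow_eLpNorm' volume (p := 2) (by norm_num) (by norm_num)
    (continuous_oscInt (hfi.indicator hSm)).aestronglyMeasurable (ENNReal.ofReal (t / 2))
  have h5 := hC _ (hfi.indicator hSm) (hf2.indicator hSm)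
  have h6 : eLpNorm (S.indicator f) 2 volume ^ 2 =
      ∫⁻ ξ, S.indicator (fun ξ => ‖f ξ‖ₑ ^ 2) ξ := by
    rw [eLpNorm_eq_lintegral_rpow_enorm_toReal (by norm_num) (by norm_num)]
    rw [← ENNReal.rpow_natCast, ← ENNReal.rpow_mul]
    simp only [ENNReal.toReal_ofNat]
    norm_num
    refine lintegral_congr fun ξ => ?_
    by_cases hξ : ξ ∈ S <;> simp [hξ]
  have h7 : ENNReal.ofReal (t ^ 2) = 4 * ENNReal.ofReal (t / 2) ^ 2 := by
    rw [← ENNReal.ofReal_pow (by positivity), show (4 : ℝ≥0∞) = ENNReal.ofReal 4 by norm_num,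
      ← ENNReal.ofReal_mul (by norm_num)]
    congr 1; ring
  calc volume {z | t < ‖oscInt f z‖} * ENNReal.ofReal (t ^ 2)
      = 4 * (ENNReal.ofReal (t / 2) ^ 2 * volume {z | t < ‖oscInt f z‖}) := by rw [h7]; ring
    _ ≤ 4 * (ENNReal.ofReal (t / 2) ^ 2 *
        volume {z | ENNReal.ofReal (t / 2) ≤ ‖oscInt (S.indicator f) z‖ₑ}) := by gcongr
    _ ≤ 4 * eLpNorm (oscInt (S.indicator f)) 2 volume ^ 2 := by
        gcongr
        simpa using hcheb
    _ ≤ 4 * (C * eLpNorm (S.indicator f) 2 volume) ^ 2 := by gcongr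
    _ = _ := by rw [mul_pow, h6]; ring

theorem lintegral_rpow_sub_three_le {s : ℝ} (hs : 2 < s) {b : ℝ} (hb : 0 ≤ b) :
    ∫⁻ t in Set.Ioc 0 b, ENNReal.ofReal (t ^ (s - 3)) = ENNReal.ofReal (b ^ (s - 2) / (s - 2)) := by
  have hint : IntervalIntegrable (fun t : ℝ => t ^ (s - 3)) volume 0 b :=
    intervalIntegral.intervalIntegrable_rpow' (by linarith)
  rw [← ofReal_integral_eq_lintegral_ofReal]
  · rw [← intervalIntegral.integral_of_le hb, integral_rpow (Or.inl (by linarith))]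
    rw [show s - 3 + 1 = s - 2 by ring, Real.zero_rpow (by linarith), sub_zero]
  · exact (intervalIntegrable_iff_integrableOn_Ioc_of_le hb).1 hint
  · filter_upwards [self_mem_ae_restrict measurableSet_Ioc] with t ht
    exact Real.rpow_nonneg ht.1.le _

/-- For `y > 0` the constraint is `t ≤ b = 2M y^{1-s}`, and integrating `t^{s'-3}` up to `b`
converges because `s' > 2`. Conjugacy gives `2 - (s-1)(s'-2) = s`, the resulting power of `y`. -/
theorem lintegral_indicator_rpow_le {s s' : ℝ} (hs : 1 < s) (hs' : s' = s / (s - 1))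
    (hs2 : 2 < s') {M y : ℝ} (hM : 0 < M) (hy : 0 ≤ y) :
    ∫⁻ t in Set.Ioi (0 : ℝ), {t : ℝ | t * y ^ (s - 1) ≤ 2 * M}.indicator
      (fun t => ENNReal.ofReal (y ^ 2 * t ^ (s' - 3))) t ≤
      ENNReal.ofReal ((2 * M) ^ (s' - 2) / (s' - 2) * y ^ s) := by
  rcases hy.eq_or_lt with rfl | hy
  · simp
  set b := 2 * M * (y ^ (s - 1))⁻¹ with hb
  have hyp : 0 < y ^ (s - 1) := Real.rpow_pos_of_pos hy _
  have hb0 : 0 ≤ b := by positivity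
  have hset : MeasurableSet {t : ℝ | t * y ^ (s - 1) ≤ 2 * M} :=
    measurableSet_le (measurable_id.mul_const _) measurable_const
  rw [← lintegral_indicator measurableSet_Ioi]
  calc _ ≤ ∫⁻ t, (Set.Ioc 0 b).indicator
        (fun t => ENNReal.ofReal (y ^ 2) * ENNReal.ofReal (t ^ (s' - 3))) t := by
        refine lintegral_mono fun t => ?_
        rw [Set.indicator_indicator]
        refine (Set.indicator_le_indicator_of_subset (t := Set.Ioc 0 b) ?_
          (fun _ => zero_le) t).trans (le_of_eq ?_)
        · rintro t ⟨h1, h2⟩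
          refine ⟨h1, ?_⟩
          rw [hb, ← div_eq_mul_inv, le_div_iff₀ hyp]
          exact h2
        · congr 1; ext t
          rw [ENNReal.ofReal_mul (by positivity)]
    _ = ENNReal.ofReal (y ^ 2) * ENNReal.ofReal (b ^ (s' - 2) / (s' - 2)) := by
        rw [lintegral_indicator measurableSet_Ioc, lintegral_const_mul' _ _ (by simp),
          lintegral_rpow_sub_three_le hs2 hb0]
    _ ≤ _ := by
        rw [← ENNReal.ofReal_mul (by positivity)]
        refine ENNReal.ofReal_le_ofReal (le_of_eq ?_)
        rw [hb, Real.mul_rpow (by positivity) (by positivity), ← Real.rpow_neg hy.le,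
          ← Real.rpow_mul hy.le]
        have : y ^ s = y ^ 2 * y ^ (-(s - 1) * (s' - 2)) := by
          rw [← Real.rpow_natCast, ← Real.rpow_add hy]
          congr 1
          have : s - 1 ≠ 0 := by linarith
          rw [hs']; field_simp; push_cast; ring
        rw [this]; ring

/-- This is the Marcinkiewicz argument: insert the weak type bound into the layer-cake formula and
exchange the integrals in `t` and `ξ`. Because the splitting height depends on `t` and `M`, the
inner integral returns exactly `|f|^s`. -/
theorem lintegral_oscInt_rpow_le {C : ℝ≥0} (hC : ∀ f : EuclideanSpace ℝ (Fin n) → ℂ,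
    Integrable f → MemLp f 2 → eLpNorm (oscInt f) 2 volume ≤ C * eLpNorm f 2 volume)
    {f : E → ℂ} (hf : Continuous f) (hfs : HasCompactSupport f) {s s' : ℝ} (hs : 1 < s)
    (hs' : s' = s / (s - 1)) (hs2 : 2 < s') {M : ℝ} (hM : 0 < M) (hMf : ∫ ξ, ‖f ξ‖ ^ s = M) :
    ∫⁻ z, ‖oscInt f z‖ₑ ^ s' ≤
      ENNReal.ofReal (4 * s' * C ^ 2 * (2 ^ (s' - 2) / (s' - 2)) * M ^ (s' - 1)) := by
  have hcs : Continuous fun ξ => ‖f ξ‖ ^ s := hf.norm.rpow_const fun _ => Or.inr (by linarith)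
  have hfi : Integrable f := hf.integrable_of_hasCompactSupport hfs
  have hfis : Integrable fun ξ => ‖f ξ‖ ^ s := by
    refine hcs.integrable_of_hasCompactSupport (hfs.comp_left (g := fun w : ℂ => ‖w‖ ^ s) ?_)
    simp [Real.zero_rpow (by linarith : s ≠ 0)]
  have hosc := (continuous_oscInt hfi).norm
  have hlc := lintegral_rpow_eq_lintegral_meas_lt_mul (volume : Measure E)
    (f := fun z => ‖oscInt f z‖) (Filter.Eventually.of_forall fun z => norm_nonneg _)
    hosc.aemeasurable (p := s') (by linarith)
  have e0 : ∫⁻ z, ‖oscInt f z‖ₑ ^ s' = ∫⁻ z, ENNReal.ofReal (‖oscInt f z‖ ^ s') := by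
    refine lintegral_congr fun z => ?_
    rw [← ENNReal.ofReal_rpow_of_nonneg (norm_nonneg _) (by linarith), ofReal_norm]
  rw [e0, hlc]
  let H : ℝ → E → ℝ≥0∞ := fun t ξ => {p : ℝ × E | p.1 * ‖f p.2‖ ^ (s - 1) ≤ 2 * M}.indicator
    (fun p => ENNReal.ofReal (‖f p.2‖ ^ 2 * p.1 ^ (s' - 3))) (t, ξ)
  have hH : Measurable (Function.uncurry H) := by
    refine Measurable.indicator ?_ ?_
    · have := hf.measurable
      fun_prop
    · refine measurableSet_le ?_ measurable_const
      exact measurable_fst.mul ((hf.measurable.comp measurable_snd).norm.pow_const _)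
  have hstep : ∀ t ∈ Set.Ioi (0 : ℝ), volume {z | t < ‖oscInt f z‖} *
      ENNReal.ofReal (t ^ (s' - 1)) ≤ 4 * C ^ 2 * ∫⁻ ξ, H t ξ := by
    intro t ht
    have ht : 0 < t := ht
    have e1 : t ^ (s' - 1) = t ^ 2 * t ^ (s' - 3) := by
      rw [← Real.rpow_natCast, ← Real.rpow_add ht]; congr 1; push_cast; ring
    rw [e1, ENNReal.ofReal_mul (by positivity), ← mul_assoc]
    refine (mul_le_mul_left (measure_lt_norm_oscInt_le hC hf hfs hs hM hMf ht) _).trans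
      (le_of_eq ?_)
    rw [mul_assoc, ← lintegral_mul_const' _ _ (by simp)]
    congr 1
    refine lintegral_congr fun ξ => ?_
    simp only [H, Set.indicator, Set.mem_ofPred_eq]
    split_ifs with h
    · rw [ENNReal.ofReal_mul (by positivity), ENNReal.ofReal_pow (norm_nonneg _), ofReal_norm]
    · simp
  calc _ ≤ ENNReal.ofReal s' * ∫⁻ t in Set.Ioi (0 : ℝ), 4 * C ^ 2 * ∫⁻ ξ, H t ξ := by
        gcongr 1
        exact setLIntegral_mono' measurableSet_Ioi hstep
    _ = ENNReal.ofReal s' * (4 * C ^ 2 * ∫⁻ ξ, ∫⁻ t in Set.Ioi (0 : ℝ), H t ξ) := by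
        rw [lintegral_const_mul' _ _ (ENNReal.mul_ne_top (by simp) (by simp)),
          lintegral_lintegral_swap hH.aemeasurable]
    _ ≤ ENNReal.ofReal s' * (4 * C ^ 2 *
          ∫⁻ ξ, ENNReal.ofReal ((2 * M) ^ (s' - 2) / (s' - 2) * ‖f ξ‖ ^ s)) := by
        gcongr with ξ
        exact lintegral_indicator_rpow_le hs hs' hs2 hM (norm_nonneg (f ξ))
    _ = ENNReal.ofReal s' * (4 * C ^ 2 *
          ENNReal.ofReal ((2 * M) ^ (s' - 2) / (s' - 2) * M)) := by
        rw [← ofReal_integral_eq_lintegral_ofReal (hfis.const_mul _), integral_const_mul, hMf]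
        refine Filter.Eventually.of_forall fun ξ => ?_
        have : 0 < s' - 2 := by linarith
        positivity
    _ = _ := by
        have : 0 < s' - 2 := by linarith
        rw [show (4 * (C : ℝ≥0∞) ^ 2) = ENNReal.ofReal (4 * C ^ 2) by
          rw [ENNReal.ofReal_mul (by norm_num), ENNReal.ofReal_pow (by positivity)]; simp]
        rw [← ENNReal.ofReal_mul (by positivity), ← ENNReal.ofReal_mul (by linarith)]
        congr 1
        rw [Real.mul_rpow (by norm_num) hM.le, show s' - 1 = (s' - 2) + 1 by ring,
          Real.rpow_add hM, Real.rpow_one]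
        ring

/-- The Hausdorff-Young inequality for continuous functions with compact support. -/
theorem exists_eLpNorm_oscInt_le (n : ℕ) {s s' : ℝ≥0∞} (hss : s.HolderConjugate s')
    (h1 : 1 ≤ s) (h2 : s ≤ 2) : ∃ C : ℝ≥0, ∀ f : EuclideanSpace ℝ (Fin n) → ℂ,
    Continuous f → HasCompactSupport f →
      eLpNorm (oscInt f) s' volume ≤ C * eLpNorm f s volume := by
  rcases h1.eq_or_lt with rfl | h1
  · have : s' = ⊤ := by
      have := hss.inv_add_inv_eq_one
      rw [inv_one] at this
      have h0 : s'⁻¹ = 0 := by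
        refine (ENNReal.add_right_inj ENNReal.one_ne_top).1 (this.trans (add_zero _).symm)
      exact ENNReal.inv_eq_zero.1 h0
    subst this
    refine ⟨1, fun f _ _ => ?_⟩
    rw [ENNReal.coe_one, one_mul, eLpNorm_exponent_top]
    exact eLpNormEssSup_le_of_ae_enorm_bound
      (Filter.Eventually.of_forall fun z => enorm_oscInt_le f z)
  obtain ⟨C, hC⟩ := exists_eLpNorm_oscInt_two_le n
  rcases h2.eq_or_lt with rfl | h2
  · have : s' = 2 := ENNReal.HolderConjugate.unique 2 s' 2
    subst this
    exact ⟨C, fun f hf hfs => hC f (hf.integrable_of_hasCompactSupport hfs)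
      (hf.memLp_of_hasCompactSupport hfs)⟩
  have hst : s ≠ ⊤ := (h2.trans (by norm_num)).ne
  have hs0 : s ≠ 0 := (zero_lt_one.trans h1).ne'
  have hr1 : 1 < s.toReal := by
    rw [← ENNReal.toReal_one]; exact (ENNReal.toReal_lt_toReal ENNReal.one_ne_top hst).2 h1
  have hr2 : s.toReal < 2 := by
    rw [← ENNReal.toReal_ofNat]; exact (ENNReal.toReal_lt_toReal hst (by norm_num)).2 h2
  set r := s.toReal with hr
  set r' := r / (r - 1) with hr'
  have hrr : r.HolderConjugate r' := Real.HolderConjugate.conjExponent hr1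
  have hr'2 : 2 < r' := by rw [hr', lt_div_iff₀ (by linarith)]; linarith
  have hs' : s' = ENNReal.ofReal r' := by
    have : s = ENNReal.ofReal r := (ENNReal.ofReal_toReal hst).symm
    have hc : s.HolderConjugate (ENNReal.ofReal r') := by
      rw [this]; exact hrr.ennrealOfReal
    exact ENNReal.HolderConjugate.unique s _ _
  have hs'0 : s' ≠ 0 := by rw [hs']; simp; linarith
  have hs't : s' ≠ ⊤ := by rw [hs']; simp
  have hs'r : s'.toReal = r' := by rw [hs', ENNReal.toReal_ofReal (by linarith)]
  set A : ℝ := 4 * r' * C ^ 2 * (2 ^ (r' - 2) / (r' - 2)) with hA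
  have hA0 : 0 ≤ A := by
    have : 0 < r' - 2 := by linarith
    positivity
  refine ⟨Real.toNNReal (A ^ (1 / r')), fun f hf hfs => ?_⟩
  have hcs : Continuous fun ξ => ‖f ξ‖ ^ r := hf.norm.rpow_const fun _ => Or.inr (by linarith)
  have hfis : Integrable fun ξ => ‖f ξ‖ ^ r := by
    refine hcs.integrable_of_hasCompactSupport (hfs.comp_left (g := fun w : ℂ => ‖w‖ ^ r) ?_)
    simp [Real.zero_rpow (by linarith : r ≠ 0)]
  set M := ∫ ξ, ‖f ξ‖ ^ r with hM
  have hMs : eLpNorm f s volume = ENNReal.ofReal (M ^ (1 / r)) := by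
    rw [eLpNorm_eq_lintegral_rpow_enorm_toReal hs0 hst, ← hr,
      ← ENNReal.ofReal_rpow_of_nonneg (integral_nonneg fun _ => by positivity) (by positivity),
      ofReal_integral_eq_lintegral_ofReal hfis (Filter.Eventually.of_forall fun _ => by positivity)]
    congr 1
    refine lintegral_congr fun z => ?_
    rw [← ENNReal.ofReal_rpow_of_nonneg (norm_nonneg _) (by linarith), ofReal_norm]
  have hM0 : 0 ≤ M := integral_nonneg fun _ => by positivity
  -- The splitting height involves division by `M`, so the case where `f` vanishes almost everywhere
  -- is separate.
  rcases hM0.eq_or_lt with h0 | h0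
  · have hz : eLpNorm f s volume = 0 := by
      rw [hMs, ← h0, Real.zero_rpow (by positivity), ENNReal.ofReal_zero]
    have hz' := (eLpNorm_eq_zero_iff hf.aestronglyMeasurable hs0).1 hz
    have : oscInt f = 0 := by
      ext z
      refine integral_eq_zero_of_ae ?_
      filter_upwards [hz'] with ξ hξ
      simp [hξ]
    rw [this, eLpNorm_zero]
    exact zero_le
  · have := lintegral_oscInt_rpow_le hC hf hfs hr1 hr' hr'2 h0 hM.symm
    rw [eLpNorm_eq_lintegral_rpow_enorm_toReal hs'0 hs't, hs'r, hMs]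
    calc _ ≤ ENNReal.ofReal (A * M ^ (r' - 1)) ^ (1 / r') := by gcongr
      _ = ENNReal.ofReal (A ^ (1 / r') * M ^ (1 / r)) := by
        rw [ENNReal.ofReal_rpow_of_nonneg (by positivity) (by positivity),
          Real.mul_rpow hA0 (by positivity), ← Real.rpow_mul hM0]
        -- The exponents agree because `(r' - 1) / r' = 1 / r`.
        congr 3
        rw [hr']
        have : r - 1 ≠ 0 := by linarith
        field_simp
        ring
      _ = _ := by rw [ENNReal.ofReal_mul (by positivity)]; rfl

end HausdorffYoung

/-! ### Pure coordinate derivatives: Leibniz rule, dilations, locality -/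

section Derivatives

variable {n : ℕ}

local notation "E" => EuclideanSpace ℝ (Fin n)

theorem contDiff_partialDeriv {f : E → ℂ} (hf : ContDiff ℝ ∞ f) (i : Fin n) :
    ContDiff ℝ ∞ (partialDeriv i f) :=
  (hf.fderiv_right (m := ∞) le_rfl).clm_apply contDiff_const

theorem contDiff_iterate_partialDeriv {f : E → ℂ} (hf : ContDiff ℝ ∞ f) (i : Fin n) (j : ℕ) :
    ContDiff ℝ ∞ ((partialDeriv i)^[j] f) := by
  induction j with
  | zero => exact hf
  | succ j ih => rw [Function.iterate_succ_apply']; exact contDiff_partialDeriv ih i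

theorem hasCompactSupport_partialDeriv {f : E → ℂ} (hf : HasCompactSupport f) (i : Fin n) :
    HasCompactSupport (partialDeriv i f) :=
  (hf.fderiv (𝕜 := ℝ)).comp_left (g := fun T : E →L[ℝ] ℂ => T (EuclideanSpace.single i 1)) rfl

theorem hasCompactSupport_iterate_partialDeriv {f : E → ℂ} (hf : HasCompactSupport f)
    (i : Fin n) (j : ℕ) : HasCompactSupport ((partialDeriv i)^[j] f) := by
  induction j with
  | zero => exact hf
  | succ j ih => rw [Function.iterate_succ_apply']; exact hasCompactSupport_partialDeriv ih i

theorem foldr_iterate_single {β : Type*} (D : Fin n → β → β) (i : Fin n) (j : ℕ) (f : β)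
    (l : List (Fin n)) (hl : l.Nodup) :
    l.foldr (fun k g => (D k)^[(Pi.single i j : Fin n → ℕ) k] g) f =
      if i ∈ l then (D i)^[j] f else f := by
  induction l with
  | nil => simp
  | cons k l ih =>
    rw [List.foldr_cons, ih hl.of_cons]
    rcases eq_or_ne k i with rfl | hki
    · simp [(List.nodup_cons.1 hl).1]
    · simp [hki, hki.symm]

/-- The weight contains only powers of single coordinates, so pure derivatives `∂_i^j` are the only
ones the proof uses. -/
theorem multiDeriv_single (i : Fin n) (j : ℕ) (f : E → ℂ) :
    multiDeriv (Pi.single i j) f = (partialDeriv i)^[j] f := by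
  rw [multiDeriv, foldr_iterate_single _ _ _ _ _ (List.nodup_finRange n),
    if_pos (List.mem_finRange i)]

theorem order_single (i : Fin n) (j : ℕ) : order (Pi.single i j) = j := by
  simp [order]

theorem multiDeriv_zero (f : E → ℂ) : multiDeriv 0 f = f := by
  have : ∀ l : List (Fin n), l.foldr (fun i g => (partialDeriv i)^[(0 : Fin n → ℕ) i] g) f = f := by
    intro l
    induction l with
    | nil => rfl
    | cons k l ih => rw [List.foldr_cons, ih]; rfl
  exact this _

/-- Restricting to a line parallel to the axis reduces the Leibniz rule to the one-variable one. -/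
theorem iterate_partialDeriv_eq_iteratedDeriv {f : E → ℂ} (hf : ContDiff ℝ ∞ f) (i : Fin n)
    (j : ℕ) (ξ : E) (t : ℝ) :
    (partialDeriv i)^[j] f (ξ + t • EuclideanSpace.single i 1) =
      iteratedDeriv j (fun t : ℝ => f (ξ + t • EuclideanSpace.single i 1)) t := by
  induction j generalizing t with
  | zero => simp
  | succ j ih =>
    rw [iteratedDeriv_succ, Function.iterate_succ_apply', ← funext ih]
    have hd : HasFDerivAt ((partialDeriv i)^[j] f)
        (fderiv ℝ ((partialDeriv i)^[j] f) (ξ + t • EuclideanSpace.single i 1))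
        (ξ + t • EuclideanSpace.single i 1) :=
      ((contDiff_iterate_partialDeriv hf i j).differentiable (by simp) _).hasFDerivAt
    have hl : HasDerivAt (fun t : ℝ => ξ + t • (EuclideanSpace.single i 1 : E))
        (EuclideanSpace.single i 1) t := by
      simpa using ((hasDerivAt_id t).smul_const (EuclideanSpace.single i 1 : E)).const_add ξ
    exact (hd.comp_hasDerivAt t hl).deriv.symm

/-- The Leibniz rule for repeated derivatives in a coordinate direction. -/
theorem iterate_partialDeriv_mul {f g : E → ℂ} (hf : ContDiff ℝ ∞ f) (hg : ContDiff ℝ ∞ g)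
    (i : Fin n) (L : ℕ) (ξ : E) :
    (partialDeriv i)^[L] (fun ξ => f ξ * g ξ) ξ = ∑ j ∈ Finset.range (L + 1),
      (L.choose j : ℂ) * (partialDeriv i)^[j] f ξ * (partialDeriv i)^[L - j] g ξ := by
  have e : ∀ {h : E → ℂ} (_ : ContDiff ℝ ∞ h) (j : ℕ), (partialDeriv i)^[j] h ξ =
      iteratedDeriv j (fun t : ℝ => h (ξ + t • EuclideanSpace.single i 1)) 0 := by
    intro h hh j
    rw [← iterate_partialDeriv_eq_iteratedDeriv hh]; simp
  have hl : ContDiff ℝ ∞ fun t : ℝ => ξ + t • (EuclideanSpace.single i 1 : E) := by fun_prop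
  have hle : (L : ℕ∞ω) ≤ (∞ : ℕ∞ω) := by exact_mod_cast le_top
  rw [e (hf.mul hg)]
  have := iteratedDeriv_mul (n := L) (x := (0 : ℝ)) ((hf.comp hl).of_le hle).contDiffAt
    ((hg.comp hl).of_le hle).contDiffAt
  refine Eq.trans this (Finset.sum_congr rfl fun j _ => ?_)
  rw [e hf, e hg]
  rfl

theorem iterate_partialDeriv_comp_smul {f : E → ℂ} (hf : ContDiff ℝ ∞ f) (i : Fin n) (c : ℝ)
    (j : ℕ) (ξ : E) :
    (partialDeriv i)^[j] (fun ξ => f (c • ξ)) ξ = c ^ j • (partialDeriv i)^[j] f (c • ξ) := by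
  induction j generalizing ξ with
  | zero => simp
  | succ j ih =>
    rw [Function.iterate_succ_apply', Function.iterate_succ_apply', partialDeriv, funext ih]
    have hd : HasFDerivAt ((partialDeriv i)^[j] f)
        (fderiv ℝ ((partialDeriv i)^[j] f) (c • ξ)) (c • ξ) :=
      ((contDiff_iterate_partialDeriv hf i j).differentiable (by simp) _).hasFDerivAt
    have hl : HasFDerivAt (fun ξ : E => c • ξ) (c • ContinuousLinearMap.id ℝ E) ξ :=
      (hasFDerivAt_id ξ).const_smul c
    refine (DFunLike.congr_fun ((hd.comp ξ hl).const_smul (c ^ j)).fderiv _).trans ?_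
    simp [partialDeriv, pow_succ, mul_assoc]

theorem iterate_partialDeriv_eq_zero {f : E → ℂ} {U : Set E} (hU : IsOpen U)
    (hf : ∀ ξ ∈ U, f ξ = 0) (i : Fin n) (j : ℕ) :
    ∀ ξ ∈ U, (partialDeriv i)^[j] f ξ = 0 := by
  induction j with
  | zero => exact hf
  | succ j ih =>
    intro ξ hξ
    rw [Function.iterate_succ_apply', partialDeriv]
    have : (partialDeriv i)^[j] f =ᶠ[nhds ξ] fun _ => 0 := by
      filter_upwards [hU.mem_nhds hξ] with η hη using ih η hη
    rw [this.fderiv_eq]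
    simp

end Derivatives

/-! ### Weighted estimates for the convolution kernel -/

section Kernel

variable {n : ℕ}

local notation "E" => EuclideanSpace ℝ (Fin n)

/-- Differentiating the exponential produces `i z_i`; integration by parts moves the derivative to
`f`, whose compact support leaves no boundary term. -/
theorem norm_coord_mul_norm_oscInt {f : E → ℂ} (hf : ContDiff ℝ ∞ f) (hfs : HasCompactSupport f)
    (i : Fin n) (z : E) : |z i| * ‖oscInt f z‖ = ‖oscInt (partialDeriv i f) z‖ := by
  let e : E → ℂ := fun ξ => Complex.exp (Complex.I * ((inner ℝ z ξ : ℝ) : ℂ))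
  have hde : ∀ ξ, fderiv ℝ e ξ (EuclideanSpace.single i 1) = Complex.I * (z i : ℂ) * e ξ := by
    intro ξ
    have h1 : HasFDerivAt (fun ξ : E => Complex.I * ((inner ℝ z ξ : ℝ) : ℂ))
        (Complex.I • (Complex.ofRealCLM.comp (innerSL ℝ z))) ξ :=
      ((Complex.ofRealCLM.comp (innerSL ℝ z)).hasFDerivAt).const_mul Complex.I
    rw [h1.cexp.fderiv]
    simp [e, EuclideanSpace.inner_single_right]
    ring
  have hec : ContDiff ℝ ∞ e := by
    have : ContDiff ℝ ∞ fun ξ : E => Complex.I * ((inner ℝ z ξ : ℝ) : ℂ) :=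
      contDiff_const.mul (Complex.ofRealCLM.contDiff.comp (contDiff_const.inner ℝ contDiff_id))
    exact this.cexp
  have hfc := hf.continuous
  have hpc := (contDiff_partialDeriv hf i).continuous
  have hps := hasCompactSupport_partialDeriv hfs i
  have hec' := hec.continuous
  have ibp := integral_mul_fderiv_eq_neg_fderiv_mul_of_integrable (μ := (volume : Measure E))
    (f := e) (g := f) (v := EuclideanSpace.single i 1) ?_ ?_ ?_
    (fun ξ _ => hec.differentiable (by simp) ξ) (fun ξ _ => hf.differentiable (by simp) ξ)
  · have h2 : oscInt (partialDeriv i f) z = -(Complex.I * (z i : ℂ) * oscInt f z) := by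
      refine Eq.trans ibp ?_
      simp only [hde, mul_assoc, oscInt]
      rw [integral_const_mul, integral_const_mul]
    rw [h2, norm_neg, norm_mul, norm_mul, Complex.norm_I, one_mul, Complex.norm_real,
      Real.norm_eq_abs]
  · simp only [hde]
    exact ((continuous_const.mul hec').mul hfc).integrable_of_hasCompactSupport hfs.mul_left
  · exact (hec'.mul hpc).integrable_of_hasCompactSupport hps.mul_left
  · exact (hec'.mul hfc).integrable_of_hasCompactSupport hfs.mul_left

theorem norm_coord_pow_mul_norm_oscInt {f : E → ℂ} (hf : ContDiff ℝ ∞ f)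
    (hfs : HasCompactSupport f) (i : Fin n) (L : ℕ) (z : E) :
    |z i| ^ L * ‖oscInt f z‖ = ‖oscInt ((partialDeriv i)^[L] f) z‖ := by
  induction L with
  | zero => simp
  | succ L ih =>
    rw [Function.iterate_succ_apply', ← norm_coord_mul_norm_oscInt
      (contDiff_iterate_partialDeriv hf i L) (hasCompactSupport_iterate_partialDeriv hfs i L), ← ih]
    ring

/-- The weight `1 + ∑ (t |z_i|)^L`. -/
def weight (t : ℝ) (L : ℕ) (z : EuclideanSpace ℝ (Fin n)) : ℝ := 1 + ∑ i, (t * |z i|) ^ L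

theorem one_le_weight {t : ℝ} (ht : 0 ≤ t) (L : ℕ) (z : E) : 1 ≤ weight t L z :=
  le_add_of_nonneg_right (Finset.sum_nonneg fun _ _ => by positivity)

theorem continuous_weight (t : ℝ) (L : ℕ) : Continuous (weight t L : E → ℝ) := by
  unfold weight
  fun_prop

/-- Each monomial of the weight becomes a derivative of the symbol, and the transform inequality
`hC` is applied term by term. -/
theorem eLpNorm_weight_mul_oscInt_le {s s' : ℝ≥0∞} {C : ℝ≥0} (hs' : 1 ≤ s')
    (hC : ∀ f : EuclideanSpace ℝ (Fin n) → ℂ, Continuous f → HasCompactSupport f →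
      eLpNorm (oscInt f) s' volume ≤ C * eLpNorm f s volume)
    {f : E → ℂ} (hf : ContDiff ℝ ∞ f) (hfs : HasCompactSupport f) {t : ℝ} (ht : 0 ≤ t) (L : ℕ) :
    eLpNorm (fun z => weight t L z * ‖oscInt f z‖) s' volume ≤
      C * (eLpNorm f s volume + ∑ i, ENNReal.ofReal (t ^ L) *
        eLpNorm ((partialDeriv i)^[L] f) s volume) := by
  have hcont : ∀ g : E → ℂ, Continuous g → HasCompactSupport g →
      AEStronglyMeasurable (fun z => ‖oscInt g z‖) volume := fun g hg hgs =>
    (continuous_oscInt (hg.integrable_of_hasCompactSupport hgs)).norm.aestronglyMeasurable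
  have hD := fun i => (contDiff_iterate_partialDeriv hf i L).continuous
  have hDs := fun i => hasCompactSupport_iterate_partialDeriv hfs i L
  have e : (fun z => weight t L z * ‖oscInt f z‖) = (fun z => ‖oscInt f z‖) +
      ∑ i, t ^ L • fun z => ‖oscInt ((partialDeriv i)^[L] f) z‖ := by
    ext z
    simp only [weight, add_mul, one_mul, Finset.sum_mul, mul_pow, mul_assoc,
      norm_coord_pow_mul_norm_oscInt hf hfs, Pi.add_apply, Finset.sum_apply, Pi.smul_apply,
      smul_eq_mul]
  rw [e, mul_add, Finset.mul_sum]
  refine (eLpNorm_add_le (hcont f hf.continuous hfs) ?_ hs').trans ?_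
  · exact Finset.aestronglyMeasurable_sum _ fun i _ => (hcont _ (hD i) (hDs i)).const_smul _
  refine add_le_add ?_ ((eLpNorm_sum_le (fun i _ => (hcont _ (hD i) (hDs i)).const_smul _)
    hs').trans (Finset.sum_le_sum fun i _ => ?_))
  · rw [eLpNorm_norm]; exact hC f hf.continuous hfs
  · rw [eLpNorm_const_smul, eLpNorm_norm, Real.enorm_eq_ofReal (by positivity), mul_left_comm]
    gcongr
    exact hC _ (hD i) (hDs i)

/-- Fubini, legitimate since `f` and `u` are both integrable, gives the kernel form of the operator
with frozen symbol. -/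
theorem integral_exp_mul_fourierHat {f : E → ℂ} (hf : Integrable f) {u : E → ℂ}
    (hu : Integrable u) (x : E) :
    ∫ ξ, Complex.exp (Complex.I * ((inner ℝ x ξ : ℝ) : ℂ)) * f ξ * fourierHat u ξ =
      ∫ z, oscInt f z * u (x - z) := by
  have hint : Integrable (Function.uncurry fun ξ y : E =>
      Complex.exp (Complex.I * ((inner ℝ (x - y) ξ : ℝ) : ℂ)) * (f ξ * u y))
      (volume.prod volume) := by
    refine (hf.mul_prod hu).bdd_mul (c := 1) ?_ (Filter.Eventually.of_forall fun ξ => ?_)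
    · refine Continuous.aestronglyMeasurable ?_
      fun_prop
    · rw [norm_exp_I_mul]
  calc _ = ∫ ξ, ∫ y, Complex.exp (Complex.I * ((inner ℝ (x - y) ξ : ℝ) : ℂ)) * (f ξ * u y) := by
        congr 1; ext ξ
        rw [fourierHat, ← integral_const_mul]
        congr 1; ext y
        have : Complex.exp (Complex.I * ((inner ℝ (x - y) ξ : ℝ) : ℂ)) =
            Complex.exp (Complex.I * ((inner ℝ x ξ : ℝ) : ℂ)) *
              Complex.exp (-Complex.I * ((inner ℝ y ξ : ℝ) : ℂ)) := by
          rw [← Complex.exp_add, inner_sub_left]; push_cast; ring_nf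
        rw [this]; ring
    _ = ∫ y, ∫ ξ, Complex.exp (Complex.I * ((inner ℝ (x - y) ξ : ℝ) : ℂ)) * (f ξ * u y) :=
        integral_integral_swap hint
    _ = ∫ y, oscInt f (x - y) * u y := by
        congr 1; ext y
        rw [oscInt, ← integral_mul_const]
        congr 1; ext ξ
        ring
    _ = _ := by
        rw [← integral_sub_left_eq_self _ _ x]
        simp

/-- The value at `x` of the operator with the compactly supported symbol `f` is controlled by a
weighted norm of `u`. -/
theorem enorm_integral_exp_mul_fourierHat_le {s s' : ℝ≥0∞} (hss : s.HolderConjugate s') {C : ℝ≥0}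
    (hs' : 1 ≤ s')
    (hC : ∀ f : EuclideanSpace ℝ (Fin n) → ℂ, Continuous f → HasCompactSupport f →
      eLpNorm (oscInt f) s' volume ≤ C * eLpNorm f s volume)
    {f : E → ℂ} (hf : ContDiff ℝ ∞ f) (hfs : HasCompactSupport f) {t : ℝ} (ht : 0 ≤ t) (L : ℕ)
    {u : E → ℂ} (huc : Continuous u) (hu : Integrable u) (x : E) :
    ‖∫ ξ, Complex.exp (Complex.I * ((inner ℝ x ξ : ℝ) : ℂ)) * f ξ * fourierHat u ξ‖ₑ ≤
      C * (eLpNorm f s volume + ∑ i, ENNReal.ofReal (t ^ L) *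
        eLpNorm ((partialDeriv i)^[L] f) s volume) *
      eLpNorm (fun z => ENNReal.ofReal (weight t L z)⁻¹ * ‖u (x - z)‖ₑ) s volume := by
  have hfi := hf.continuous.integrable_of_hasCompactSupport (μ := volume) hfs
  have hw : ∀ z : E, 0 < weight t L z := fun z => zero_lt_one.trans_le (one_le_weight ht L z)
  rw [integral_exp_mul_fourierHat hfi hu]
  -- The weight and its inverse are inserted before Hölder: the kernel absorbs the growth, while the
  -- translate of `u` keeps the decaying factor.
  set A : E → ℝ := fun z => (weight t L z)⁻¹ * ‖u (x - z)‖
  set B : E → ℝ := fun z => weight t L z * ‖oscInt f z‖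
  have hA : AEStronglyMeasurable A volume := by
    refine Continuous.aestronglyMeasurable ?_
    exact ((continuous_weight t L).inv₀ fun z => (hw z).ne').mul (by fun_prop)
  have hB : AEStronglyMeasurable B volume :=
    ((continuous_weight t L).mul (continuous_oscInt hfi).norm).aestronglyMeasurable
  have hH : eLpNorm (A • B) 1 volume ≤ eLpNorm A s volume * eLpNorm B s' volume :=
    eLpNorm_smul_le_mul_eLpNorm hB hA
  have eA : eLpNorm A s volume =
      eLpNorm (fun z => ENNReal.ofReal (weight t L z)⁻¹ * ‖u (x - z)‖ₑ) s volume := by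
    refine eLpNorm_congr_enorm_ae (Filter.Eventually.of_forall fun z => ?_)
    simp only [A, enorm_mul, enorm_norm, enorm_eq_self]
    rw [Real.enorm_eq_ofReal (inv_nonneg.2 (hw z).le)]
  calc _ ≤ ∫⁻ z, ‖oscInt f z * u (x - z)‖ₑ := enorm_integral_le_lintegral_enorm _
    _ = eLpNorm (A • B) 1 volume := by
        rw [eLpNorm_one_eq_lintegral_enorm]
        refine lintegral_congr fun z => ?_
        rw [← enorm_norm, norm_mul]
        congr 1
        simp only [A, B, Pi.smul_apply', smul_eq_mul]
        have := (hw z).ne'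
        field_simp
    _ ≤ eLpNorm A s volume * eLpNorm B s' volume := hH
    _ ≤ _ := by
        rw [eA, mul_comm]
        gcongr
        exact eLpNorm_weight_mul_oscInt_le hs' hC hf hfs ht L

end Kernel

/-! ### The Littlewood-Paley partition and derivatives of localized symbols -/

section Cutoff

variable {n : ℕ}

local notation "E" => EuclideanSpace ℝ (Fin n)

/-- The dyadic shell `2^{k-1} ≤ ⟨ξ⟩ ≤ 2^{k+2}`. -/
def shell (n k : ℕ) : Set (EuclideanSpace ℝ (Fin n)) :=
  {ξ | 2 ^ k / 2 ≤ bracket ξ ∧ bracket ξ ≤ 4 * 2 ^ k}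

theorem continuous_bracket : Continuous (bracket : E → ℝ) := by
  unfold bracket; fun_prop

theorem isClosed_shell (k : ℕ) : IsClosed (shell n k) :=
  (isClosed_le continuous_const continuous_bracket).inter
    (isClosed_le continuous_bracket continuous_const)

theorem one_le_bracket (ξ : E) : 1 ≤ bracket ξ := by
  rw [bracket, Real.one_le_sqrt]; nlinarith [norm_nonneg ξ]

theorem norm_le_bracket (ξ : E) : ‖ξ‖ ≤ bracket ξ :=
  Real.le_sqrt_of_sq_le (by linarith)

theorem bracket_le_one_add_norm (ξ : E) : bracket ξ ≤ 1 + ‖ξ‖ := by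
  rw [bracket, Real.sqrt_le_left (by positivity)]; nlinarith [norm_nonneg ξ]

theorem isCompact_shell (k : ℕ) : IsCompact (shell n k) := by
  refine Metric.isCompact_of_isClosed_isBounded (isClosed_shell k) ?_
  refine (Metric.isBounded_closedBall (x := (0 : E)) (r := 4 * 2 ^ k)).subset fun ξ hξ => ?_
  simpa using (norm_le_bracket ξ).trans hξ.2

theorem volume_shell_le (n k : ℕ) : volume (shell n k) ≤
    ENNReal.ofReal ((4 * 2 ^ k) ^ n) * volume (Metric.ball (0 : EuclideanSpace ℝ (Fin n)) 1) := by
  calc volume (shell n k) ≤ volume (Metric.closedBall (0 : EuclideanSpace ℝ (Fin n)) (4 * 2 ^ k)) :=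
        measure_mono fun ξ hξ => by simpa using (norm_le_bracket ξ).trans hξ.2
    _ = _ := by
        rw [Measure.addHaar_closedBall _ _ (by positivity)]
        simp

theorem iterate_partialDeriv_sub {f g : E → ℂ} (hf : ContDiff ℝ ∞ f) (hg : ContDiff ℝ ∞ g)
    (i : Fin n) (j : ℕ) (ξ : E) : (partialDeriv i)^[j] (fun ξ => f ξ - g ξ) ξ =
      (partialDeriv i)^[j] f ξ - (partialDeriv i)^[j] g ξ := by
  induction j generalizing ξ with
  | zero => rfl
  | succ j ih =>
    simp only [Function.iterate_succ_apply']
    rw [partialDeriv, funext ih]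
    refine (DFunLike.congr_fun (fderiv_fun_sub
      ((contDiff_iterate_partialDeriv hf i j).differentiable (by simp) ξ)
      ((contDiff_iterate_partialDeriv hg i j).differentiable (by simp) ξ)) _)

theorem exists_norm_iterate_partialDeriv_le {f : E → ℂ} (hf : ContDiff ℝ ∞ f)
    (hfs : HasCompactSupport f) :
    ∃ M : ℕ → ℝ≥0, ∀ i j ξ, ‖(partialDeriv i)^[j] f ξ‖ ≤ M j := by
  have : ∀ j i, ∃ M : ℝ≥0, ∀ ξ, ‖(partialDeriv i)^[j] f ξ‖ ≤ M := by
    intro j i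
    obtain ⟨M, hM⟩ := (hasCompactSupport_iterate_partialDeriv hfs i j).exists_bound_of_continuous
      (contDiff_iterate_partialDeriv hf i j).continuous
    exact ⟨⟨max M 0, le_max_right _ _⟩, fun ξ => (hM ξ).trans (le_max_left _ _)⟩
  choose M hM using this
  refine ⟨fun j => ∑ i, M j i, fun i j ξ => (hM j i ξ).trans ?_⟩
  exact_mod_cast Finset.single_le_sum (f := fun i => M j i) (fun _ _ => zero_le) (Finset.mem_univ i)

/-- A smooth function equal to `1` on the unit ball and supported in the ball of radius `2`. -/
def bump (n : ℕ) : ContDiffBump (0 : EuclideanSpace ℝ (Fin n)) := ⟨1, 2, one_pos, one_lt_two⟩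

/-- The bump function dilated by `2^k`. -/
def dilatedBump (k : ℕ) (ξ : EuclideanSpace ℝ (Fin n)) : ℂ := (bump n ((2 ^ k : ℝ)⁻¹ • ξ) : ℝ)

/-- The Littlewood-Paley partition of unity. -/
def cutoff : ℕ → EuclideanSpace ℝ (Fin n) → ℂ
  | 0 => dilatedBump 0
  | k + 1 => fun ξ => dilatedBump (k + 1) ξ - dilatedBump k ξ

theorem contDiff_bump : ContDiff ℝ ∞ fun ξ : E => ((bump n ξ : ℝ) : ℂ) :=
  Complex.ofRealCLM.contDiff.comp (bump n).contDiff

theorem contDiff_dilatedBump (k : ℕ) : ContDiff ℝ ∞ (dilatedBump k : E → ℂ) :=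
  contDiff_bump.comp (contDiff_const_smul _)

theorem contDiff_cutoff (k : ℕ) : ContDiff ℝ ∞ (cutoff k : E → ℂ) := by
  cases k with
  | zero => exact contDiff_dilatedBump 0
  | succ k => exact (contDiff_dilatedBump (k + 1)).sub (contDiff_dilatedBump k)

theorem dilatedBump_eq_one {k : ℕ} {ξ : E} (h : ‖ξ‖ ≤ 2 ^ k) : dilatedBump k ξ = 1 := by
  have : bump n ((2 ^ k : ℝ)⁻¹ • ξ) = 1 := by
    refine (bump n).one_of_mem_closedBall ?_
    simp only [mem_closedBall_zero_iff, norm_smul, bump, norm_inv, norm_pow, Real.norm_ofNat]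
    rw [inv_mul_le_iff₀ (by positivity)]
    linarith
  rw [dilatedBump, this, Complex.ofReal_one]

theorem dilatedBump_eq_zero {k : ℕ} {ξ : E} (h : 2 * 2 ^ k ≤ ‖ξ‖) : dilatedBump k ξ = 0 := by
  have : bump n ((2 ^ k : ℝ)⁻¹ • ξ) = 0 := by
    refine (bump n).zero_of_le_dist ?_
    simp only [dist_zero_right, norm_smul, bump, norm_inv, norm_pow, Real.norm_ofNat]
    rw [le_inv_mul_iff₀ (by positivity)]
    linarith
  rw [dilatedBump, this, Complex.ofReal_zero]

theorem norm_dilatedBump_le (k : ℕ) (ξ : E) : ‖dilatedBump k ξ‖ ≤ 1 := by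
  rw [dilatedBump, Complex.norm_real, Real.norm_eq_abs, abs_of_nonneg (bump n).nonneg]
  exact (bump n).le_one

/-- For large `ξ` both dilated bumps vanish, and for small `ξ` both equal `1` and cancel. The
constants of the shell leave room for passing between `‖ξ‖` and `⟨ξ⟩`. -/
theorem cutoff_eq_zero {k : ℕ} {ξ : E} (h : ξ ∉ shell n k) : cutoff k ξ = 0 := by
  by_contra hne
  refine h ?_
  have h1 := one_le_bracket ξ
  have h2 := norm_le_bracket ξ
  have h3 := bracket_le_one_add_norm ξ
  have hk : (1 : ℝ) ≤ 2 ^ k := one_le_pow₀ one_le_two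
  have hup : ‖ξ‖ ≤ 2 * 2 ^ k := by
    by_contra! hlt
    refine hne ?_
    cases k with
    | zero => exact dilatedBump_eq_zero hlt.le
    | succ k =>
      simp only [cutoff]
      rw [dilatedBump_eq_zero hlt.le, dilatedBump_eq_zero, sub_zero]
      rw [pow_succ] at hlt
      linarith [pow_pos (two_pos (α := ℝ)) k]
  refine ⟨?_, by linarith⟩
  cases k with
  | zero => rw [pow_zero]; linarith
  | succ k =>
    by_contra! hlt
    rw [pow_succ] at hlt
    refine hne ?_
    simp only [cutoff]
    rw [dilatedBump_eq_one, dilatedBump_eq_one, sub_self]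
    · linarith
    · rw [pow_succ]; linarith [pow_pos (two_pos (α := ℝ)) k]

theorem hasCompactSupport_mul_cutoff (g : E → ℂ) (k : ℕ) :
    HasCompactSupport fun ξ => g ξ * cutoff k ξ :=
  HasCompactSupport.intro (isCompact_shell k) fun ξ hξ => by rw [cutoff_eq_zero hξ, mul_zero]

theorem sum_cutoff (K : ℕ) (ξ : E) :
    ∑ k ∈ Finset.range (K + 1), cutoff k ξ = dilatedBump K ξ := by
  induction K with
  | zero => simp [cutoff]
  | succ K ih => rw [Finset.sum_range_succ, ih, cutoff]; ring

theorem norm_sum_cutoff_le (K : ℕ) (ξ : E) : ‖∑ k ∈ Finset.range K, cutoff k ξ‖ ≤ 1 := by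
  cases K with
  | zero => simp
  | succ K => rw [sum_cutoff]; exact norm_dilatedBump_le K ξ

theorem tendsto_sum_cutoff (ξ : E) : Filter.Tendsto
    (fun K => ∑ k ∈ Finset.range K, cutoff k ξ) Filter.atTop (nhds 1) := by
  rw [← Filter.tendsto_add_atTop_iff_nat 1]
  refine tendsto_const_nhds.congr' ?_
  obtain ⟨N, hN⟩ := pow_unbounded_of_one_lt ‖ξ‖ (one_lt_two (α := ℝ))
  filter_upwards [Filter.eventually_ge_atTop N] with K hK
  rw [sum_cutoff, dilatedBump_eq_one]
  exact hN.le.trans (pow_le_pow_right₀ one_le_two hK)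

theorem exists_norm_iterate_partialDeriv_cutoff_le (n : ℕ) : ∃ c : ℕ → ℝ≥0,
    ∀ (k : ℕ) (i : Fin n) (j : ℕ) (ξ : EuclideanSpace ℝ (Fin n)),
      ‖(partialDeriv i)^[j] (cutoff k) ξ‖ ≤ c j * ((2 ^ k : ℝ)⁻¹) ^ j := by
  obtain ⟨M, hM⟩ := exists_norm_iterate_partialDeriv_le (contDiff_bump (n := n))
    ((bump n).hasCompactSupport.comp_left (g := fun t : ℝ => (t : ℂ)) rfl)
  have hd : ∀ (k : ℕ) (i : Fin n) (j : ℕ) (ξ : EuclideanSpace ℝ (Fin n)),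
      ‖(partialDeriv i)^[j] (dilatedBump k) ξ‖ ≤ M j * ((2 ^ k : ℝ)⁻¹) ^ j := by
    intro k i j ξ
    have := iterate_partialDeriv_comp_smul (contDiff_bump (n := n)) i (2 ^ k : ℝ)⁻¹ j ξ
    have e : (dilatedBump k : EuclideanSpace ℝ (Fin n) → ℂ) =
      fun ξ => ((bump n ((2 ^ k : ℝ)⁻¹ • ξ) : ℝ) : ℂ) := rfl
    rw [e, this, norm_smul, mul_comm]
    have h2 := hM i j ((2 ^ k : ℝ)⁻¹ • ξ)
    rw [norm_pow, norm_inv, norm_pow, Real.norm_ofNat]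
    gcongr
  -- The bump at scale `k`, measured against `2^{-(k+1)j}`, costs the extra factor `2^j`.
  refine ⟨fun j => M j * (1 + 2 ^ j), fun k i j ξ => ?_⟩
  cases k with
  | zero =>
    refine (hd 0 i j ξ).trans ?_
    gcongr
    push_cast
    have : (0 : ℝ) ≤ 2 ^ j := by positivity
    nlinarith [(M j).coe_nonneg]
  | succ k =>
    rw [cutoff, iterate_partialDeriv_sub (contDiff_dilatedBump _) (contDiff_dilatedBump _)]
    refine (norm_sub_le _ _).trans ((add_le_add (hd _ i j ξ) (hd _ i j ξ)).trans (le_of_eq ?_))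
    push_cast
    have : ((2 ^ k : ℝ)⁻¹) ^ j = 2 ^ j * ((2 ^ (k + 1) : ℝ)⁻¹) ^ j := by
      rw [← mul_pow, pow_succ]; congr 1; field_simp
    rw [this]; ring

/-- In the Leibniz rule each derivative falling on the cutoff gains `2^{-k}`, and `t ≤ 2^k` lets it
absorb one factor `t`. With `t = 2^{kϱ}` this is where `ϱ ≤ 1` enters. -/
theorem eLpNorm_iterate_partialDeriv_mul_cutoff_le {c : ℕ → ℝ≥0}
    (hc : ∀ (k : ℕ) (i : Fin n) (j : ℕ) (ξ : EuclideanSpace ℝ (Fin n)),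
      ‖(partialDeriv i)^[j] (cutoff k) ξ‖ ≤ c j * ((2 ^ k : ℝ)⁻¹) ^ j)
    {g : E → ℂ} (hg : ContDiff ℝ ∞ g) {s : ℝ≥0∞} (hs : 1 ≤ s) {k : ℕ} {t : ℝ} (ht0 : 0 < t)
    (ht : t ≤ 2 ^ k) (i : Fin n) (L : ℕ) :
    ENNReal.ofReal (t ^ L) *
      eLpNorm ((partialDeriv i)^[L] fun ξ => g ξ * cutoff k ξ) s volume ≤
      ∑ j ∈ Finset.range (L + 1), (L.choose j * c (L - j) : ℝ≥0) * (ENNReal.ofReal (t ^ j) *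
        eLpNorm ((shell n k).indicator ((partialDeriv i)^[j] g)) s volume) := by
  have hD := fun j => (contDiff_iterate_partialDeriv hg i j).continuous
  have hS := (isClosed_shell (n := n) k).measurableSet
  have hm : ∀ j, AEStronglyMeasurable (fun ξ =>
      ‖(shell n k).indicator ((partialDeriv i)^[j] g) ξ‖) volume := fun j =>
    ((hD j).aestronglyMeasurable.indicator hS).norm
  set b : ℕ → ℝ := fun j => (L.choose j * c (L - j) : ℝ≥0) * t ^ j with hb
  have hpt : ∀ ξ, ‖t ^ L • (partialDeriv i)^[L] (fun ξ => g ξ * cutoff k ξ) ξ‖ ≤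
      (∑ j ∈ Finset.range (L + 1), b j • fun ξ =>
        ‖(shell n k).indicator ((partialDeriv i)^[j] g) ξ‖) ξ := by
    intro ξ
    simp only [Finset.sum_apply, Pi.smul_apply, smul_eq_mul]
    by_cases hξ : ξ ∈ shell n k
    · simp only [Set.indicator_of_mem hξ]
      rw [iterate_partialDeriv_mul hg (contDiff_cutoff k), norm_smul, Real.norm_of_nonneg
        (by positivity)]
      refine (mul_le_mul_of_nonneg_left (norm_sum_le _ _) (by positivity)).trans ?_
      rw [Finset.mul_sum]
      refine Finset.sum_le_sum fun j hj => ?_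
      have hjL : j ≤ L := by simpa [Nat.lt_succ_iff] using hj
      rw [norm_mul, norm_mul, Complex.norm_natCast]
      have h1 := hc k i (L - j) ξ
      have h2 : t ^ L * ((2 ^ k : ℝ)⁻¹) ^ (L - j) ≤ t ^ j := by
        have e : t ^ L = t ^ j * t ^ (L - j) := by rw [← pow_add]; congr 1; omega
        rw [e, mul_assoc, ← mul_pow]
        refine mul_le_of_le_one_right (by positivity) (pow_le_one₀ (by positivity) ?_)
        rw [← div_eq_mul_inv]
        exact div_le_one_of_le₀ ht (by positivity)
      calc t ^ L * (L.choose j * ‖(partialDeriv i)^[j] g ξ‖ *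
            ‖(partialDeriv i)^[L - j] (cutoff k) ξ‖)
          ≤ t ^ L * (L.choose j * ‖(partialDeriv i)^[j] g ξ‖ *
            (c (L - j) * ((2 ^ k : ℝ)⁻¹) ^ (L - j))) := by gcongr
        _ = L.choose j * c (L - j) * ‖(partialDeriv i)^[j] g ξ‖ *
            (t ^ L * ((2 ^ k : ℝ)⁻¹) ^ (L - j)) := by ring
        _ ≤ L.choose j * c (L - j) * ‖(partialDeriv i)^[j] g ξ‖ * t ^ j := by gcongr
        _ = _ := by rw [hb]; push_cast; ring
    · rw [iterate_partialDeriv_eq_zero (isClosed_shell k).isOpen_compl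
        (fun ξ hξ => by rw [cutoff_eq_zero hξ, mul_zero]) i L ξ hξ, smul_zero, norm_zero]
      exact Finset.sum_nonneg fun j _ => mul_nonneg (by positivity) (norm_nonneg _)
  have h1 : ENNReal.ofReal (t ^ L) *
      eLpNorm ((partialDeriv i)^[L] fun ξ => g ξ * cutoff k ξ) s volume =
      eLpNorm (fun ξ => t ^ L • (partialDeriv i)^[L] (fun ξ => g ξ * cutoff k ξ) ξ) s volume := by
    have := eLpNorm_const_smul (t ^ L) ((partialDeriv i)^[L] fun ξ => g ξ * cutoff k ξ) s
      (volume : Measure E)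
    rw [Real.enorm_eq_ofReal (by positivity)] at this
    exact this.symm
  rw [h1]
  refine (eLpNorm_mono_real hpt).trans ((eLpNorm_sum_le (fun j _ => (hm j).const_smul _) hs).trans
    (le_of_eq (Finset.sum_congr rfl fun j _ => ?_)))
  rw [eLpNorm_const_smul, eLpNorm_norm, Real.enorm_eq_ofReal (by positivity), hb, ← mul_assoc,
    ENNReal.ofReal_mul (by positivity), ENNReal.ofReal_coe_nnreal]

end Cutoff

/-! ### Joint measurability and regularization of the amplitude -/

section Measurability

variable {n : ℕ}

local notation "E" => EuclideanSpace ℝ (Fin n)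

theorem measurable_uncurry_of_smooth {a : E → E → ℂ} (hs : ∀ x, ContDiff ℝ ∞ (a x))
    (hm : ∀ ξ, Measurable fun x => a x ξ) : Measurable (Function.uncurry a) := by
  have := stronglyMeasurable_uncurry_of_continuous_of_stronglyMeasurable (u := fun ξ x => a x ξ)
    (fun x => (hs x).continuous) (fun ξ => (hm ξ).stronglyMeasurable)
  exact this.measurable.comp measurable_swap

theorem measurable_partialDeriv {a : E → E → ℂ} (hs : ∀ x, ContDiff ℝ ∞ (a x))
    (hm : ∀ ξ, Measurable fun x => a x ξ) (i : Fin n) (ξ : E) :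
    Measurable fun x => partialDeriv i (a x) ξ := by
  have hlim : ∀ x, Filter.Tendsto (fun N : ℕ => (N : ℝ) •
      (a x (ξ + ((N : ℝ)⁻¹) • EuclideanSpace.single i 1) - a x ξ)) Filter.atTop
      (nhds (partialDeriv i (a x) ξ)) := by
    intro x
    have h1 : HasFDerivAt (a x) (fderiv ℝ (a x) ξ) ξ :=
      ((hs x).differentiable (by simp) ξ).hasFDerivAt
    exact h1.lim (EuclideanSpace.single i 1)
      (tendsto_norm_atTop_atTop.comp (tendsto_natCast_atTop_atTop (R := ℝ)))
  refine measurable_of_tendsto_metrizable (fun N => ?_) (tendsto_pi_nhds.2 hlim)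
  exact ((hm _).sub (hm _)).const_smul (N : ℝ)

theorem measurable_iterate_partialDeriv {a : E → E → ℂ} (hs : ∀ x, ContDiff ℝ ∞ (a x))
    (hm : ∀ ξ, Measurable fun x => a x ξ) (i : Fin n) (j : ℕ) (ξ : E) :
    Measurable fun x => (partialDeriv i)^[j] (a x) ξ := by
  induction j generalizing ξ with
  | zero => exact hm ξ
  | succ j ih =>
    simp only [Function.iterate_succ_apply']
    exact measurable_partialDeriv (fun x => contDiff_iterate_partialDeriv (hs x) i j) ih i ξ

theorem measurable_uncurry_iterate_partialDeriv {a : E → E → ℂ} (hs : ∀ x, ContDiff ℝ ∞ (a x))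
    (hm : ∀ ξ, Measurable fun x => a x ξ) (i : Fin n) (j : ℕ) :
    Measurable (Function.uncurry fun x => (partialDeriv i)^[j] (a x)) :=
  measurable_uncurry_of_smooth (fun x => contDiff_iterate_partialDeriv (hs x) i j)
    (measurable_iterate_partialDeriv hs hm i j)

/-- An amplitude agrees, for almost every `x`, with one that is smooth for every `x` and Borel
measurable in `x`. -/
theorem exists_measurable_smooth_modification {a : E → E → ℂ}
    (hm : ∀ ξ, AEStronglyMeasurable (fun x => a x ξ) volume)
    (hs : ∀ᵐ x, ContDiff ℝ ∞ (a x)) :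
    ∃ b : E → E → ℂ, (∀ x, ContDiff ℝ ∞ (b x)) ∧ (∀ ξ, Measurable fun x => b x ξ) ∧
      ∀ᵐ x, a x = b x := by
  -- The exceptional null set for Borel representatives depends on `ξ`; a countable dense set of `ξ`
  -- gives one null set, and continuity in `ξ` recovers the remaining values as limits.
  let d := TopologicalSpace.denseSeq E
  have hae : ∀ᵐ x, ContDiff ℝ ∞ (a x) ∧ ∀ k, a x (d k) = (hm (d k)).mk _ x := by
    filter_upwards [hs, ae_all_iff.2 fun k => (hm (d k)).ae_eq_mk] with x h1 h2 using ⟨h1, h2⟩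
  obtain ⟨X, hX, hXm, hXn⟩ := exists_measurable_superset_of_null (ae_iff.1 hae)
  have hgood : ∀ x ∉ X, ContDiff ℝ ∞ (a x) ∧ ∀ k, a x (d k) = (hm (d k)).mk _ x := by
    intro x hx
    by_contra h
    exact hx (hX h)
  refine ⟨Xᶜ.indicator a, fun x => ?_, fun ξ => ?_, ?_⟩
  · by_cases hx : x ∈ X
    · rw [Set.indicator_of_notMem (by simpa using hx)]
      exact contDiff_const
    · rw [Set.indicator_of_mem (by simpa using hx)]
      exact (hgood x hx).1
  · obtain ⟨v, hv, hvl⟩ := mem_closure_iff_seq_limit.1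
      ((TopologicalSpace.denseRange_denseSeq E) ξ)
    choose κ hκ using hv
    refine measurable_of_tendsto_metrizable (f := fun l x =>
      Xᶜ.indicator ((hm (d (κ l))).mk _) x) (fun l => ?_) (tendsto_pi_nhds.2 fun x => ?_)
    · exact (hm (d (κ l))).stronglyMeasurable_mk.measurable.indicator hXm.compl
    · by_cases hx : x ∈ X
      · simp only [Set.indicator_of_notMem (show x ∉ Xᶜ by simpa using hx)]
        exact tendsto_const_nhds
      · simp only [Set.indicator_of_mem (show x ∈ Xᶜ by simpa using hx)]
        have h1 := ((hgood x hx).1.continuous.tendsto ξ).comp hvl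
        refine h1.congr fun l => ?_
        rw [Function.comp_apply, ← hκ l]
        exact (hgood x hx).2 (κ l)
  · filter_upwards [compl_mem_ae_iff.2 hXn] with x hx
    rw [Set.indicator_of_mem hx]

end Measurability

/-! ### Integrability and scaling of the inverse weight -/

section WeightedNorm

variable {n : ℕ}

local notation "E" => EuclideanSpace ℝ (Fin n)

theorem norm_le_sum_abs (z : E) : ‖z‖ ≤ ∑ i, |z i| := by
  rw [EuclideanSpace.norm_eq, Real.sqrt_le_left (Finset.sum_nonneg fun _ _ => abs_nonneg _)]
  simpa using Finset.sum_sq_le_sq_sum_of_nonneg (s := Finset.univ) (f := fun i => |z i|)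
    fun _ _ => abs_nonneg _

theorem one_add_norm_pow_le_weight (z : E) :
    (1 + ‖z‖) ^ (n + 1) ≤ (n + 1 : ℝ) ^ n * weight 1 (n + 1) z := by
  -- Power mean inequality for the `n + 1` numbers `1, |z_1|, …, |z_n|`.
  have h := pow_sum_div_card_le_sum_pow (s := (Finset.univ : Finset (Fin (n + 1))))
    (f := (Fin.cons 1 (fun i => |z i|) : Fin (n + 1) → ℝ)) (fun i _ => by
      refine Fin.cases ?_ (fun i => ?_) i
      · simp
      · simp) n
  simp only [Fin.sum_univ_succ, Fin.cons_zero, Fin.cons_succ, Finset.card_univ, Fintype.card_fin,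
    one_pow] at h
  rw [div_le_iff₀ (by positivity)] at h
  calc (1 + ‖z‖) ^ (n + 1) ≤ (1 + ∑ i, |z i|) ^ (n + 1) := by
        gcongr; exact norm_le_sum_abs z
    _ ≤ _ := by
        refine h.trans (le_of_eq ?_)
        simp only [weight, one_mul]
        push_cast
        ring

/-- The exponent `n + 1` exceeds the dimension, so the inverse weight is integrable; being at most
`1`, it then lies in every `L^s` with finite `s ≥ 1`. -/
theorem eLpNorm_inv_weight_lt_top {s : ℝ≥0∞} (hs : 1 ≤ s) (hst : s ≠ ⊤) :
    eLpNorm (fun z : E => (weight 1 (n + 1) z)⁻¹) s volume < ⊤ := by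
  have h1 : ∀ z : E, 1 ≤ weight 1 (n + 1) z := one_le_weight zero_le_one _
  have hc : Continuous fun z : E => (weight 1 (n + 1) z)⁻¹ :=
    (continuous_weight 1 (n + 1)).inv₀ fun z => (zero_lt_one.trans_le (h1 z)).ne'
  have hint : Integrable fun z : E => (weight 1 (n + 1) z)⁻¹ := by
    have h2 := integrable_one_add_norm (μ := (volume : Measure E)) (r := (n : ℝ) + 1) (by simp)
    refine (h2.const_mul ((n + 1 : ℝ) ^ n)).mono' hc.aestronglyMeasurable
      (Filter.Eventually.of_forall fun z => ?_)
    have h3 := one_add_norm_pow_le_weight z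
    have h4 : 0 < weight 1 (n + 1) z := zero_lt_one.trans_le (h1 z)
    rw [Real.norm_of_nonneg (inv_nonneg.2 h4.le), Real.rpow_neg (by positivity),
      ← div_eq_mul_inv]
    rw [show ((n : ℝ) + 1) = ((n + 1 : ℕ) : ℝ) by push_cast; ring, Real.rpow_natCast]
    rw [le_div_iff₀ (by positivity), inv_mul_le_iff₀ h4, mul_comm]
    push_cast
    exact h3
  have hs0 : s ≠ 0 := (zero_lt_one.trans_le hs).ne'
  have hs1 : 1 ≤ s.toReal := by
    rw [← ENNReal.toReal_one]; exact ENNReal.toReal_mono hst hs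
  rw [eLpNorm_lt_top_iff_lintegral_rpow_enorm_lt_top hs0 hst]
  refine lt_of_le_of_lt (lintegral_mono fun z => ?_) hint.2
  refine ENNReal.rpow_le_self_of_le_one ?_ hs1
  rw [Real.enorm_eq_ofReal (inv_nonneg.2 (zero_le_one.trans (h1 z))), ENNReal.ofReal_le_one]
  exact inv_le_one_of_one_le₀ (h1 z)

/-- The weight with parameter `t` is the one with parameter `1` evaluated at `t z`, so the power of
`t` is the Jacobian. -/
theorem eLpNorm_inv_weight {s : ℝ≥0∞} (hst : s ≠ ⊤) {t : ℝ} (ht : 0 < t) (L : ℕ) :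
    eLpNorm (fun z : E => ENNReal.ofReal (weight t L z)⁻¹) s volume =
      ENNReal.ofReal (t ^ (-(n / s.toReal))) *
        eLpNorm (fun z : E => (weight 1 L z)⁻¹) s volume := by
  have h1 : ∀ z : E, 1 ≤ weight 1 L z := one_le_weight zero_le_one _
  have hc : Continuous fun z : E => (weight 1 L z)⁻¹ :=
    (continuous_weight 1 L).inv₀ fun z => (zero_lt_one.trans_le (h1 z)).ne'
  have e1 : eLpNorm (fun z : E => ENNReal.ofReal (weight t L z)⁻¹) s volume =
      eLpNorm ((fun z : E => (weight 1 L z)⁻¹) ∘ (t • ·)) s volume := by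
    refine eLpNorm_congr_enorm_ae (Filter.Eventually.of_forall fun z => ?_)
    have : weight 1 L (t • z) = weight t L z := by
      simp [weight, abs_mul, abs_of_pos ht]
    simp only [enorm_eq_self, Function.comp_apply, this]
    rw [Real.enorm_eq_ofReal (inv_nonneg.2 (zero_le_one.trans (one_le_weight ht.le L z)))]
  rw [e1, ← eLpNorm_map_measure (by exact hc.aestronglyMeasurable) (by fun_prop),
    Measure.map_addHaar_smul _ ht.ne', eLpNorm_smul_measure_of_ne_top hst, smul_eq_mul]
  congr 1
  simp only [finrank_euclideanSpace, Fintype.card_fin]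
  rw [ENNReal.ofReal_rpow_of_nonneg (by positivity) (by positivity)]
  congr 1
  rw [abs_of_pos (by positivity), ← Real.rpow_natCast, ← Real.rpow_neg ht.le, ← Real.rpow_mul ht.le]
  congr 1
  rw [ENNReal.toReal_div, ENNReal.toReal_one]
  ring

/-- By Minkowski, available as `s ≤ q`, the `L^q` norm in `x` is taken inside, where translation
invariance removes `z`. -/
theorem eLpNorm_convolution_weight_le {s q : ℝ≥0∞} (hs : 1 ≤ s) (hst : s ≠ ⊤) (hq : s ≤ q)
    (t : ℝ) (L : ℕ) {u : E → ℂ} (hu : Continuous u) :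
    eLpNorm (fun x => eLpNorm (fun z => ENNReal.ofReal (weight t L z)⁻¹ * ‖u (x - z)‖ₑ) s volume) q
        volume ≤
      eLpNorm (fun z : E => ENNReal.ofReal (weight t L z)⁻¹) s volume * eLpNorm u q volume := by
  have hw : Measurable fun z : E => ENNReal.ofReal (weight t L z)⁻¹ :=
    (continuous_weight t L).measurable.inv.ennreal_ofReal
  refine (eLpNorm_eLpNorm_le (F := fun x z => ENNReal.ofReal (weight t L z)⁻¹ * ‖u (x - z)‖ₑ)
    (g := fun z => ENNReal.ofReal (weight t L z)⁻¹ * eLpNorm u q volume) ?_ hs hst hq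
    (fun z => ?_) (hw.mul_const _)).trans ?_
  · refine (hw.comp measurable_snd).mul ?_
    have : Continuous fun p : E × E => u (p.1 - p.2) := by fun_prop
    exact this.measurable.enorm
  · have h1 := eLpNorm_le_nnreal_smul_eLpNorm_of_ae_le_mul' (μ := volume) (f := fun x =>
      ENNReal.ofReal (weight t L z)⁻¹ * ‖u (x - z)‖ₑ) (g := fun x => u (x - z))
      (c := (weight t L z)⁻¹.toNNReal) (Filter.Eventually.of_forall fun x => le_rfl) q
    have h2 := eLpNorm_comp_measurePreserving (p := q) hu.aestronglyMeasurable
      (measurePreserving_sub_right (volume : Measure E) z)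
    refine h1.trans (le_of_eq ?_)
    rw [show eLpNorm (fun x => u (x - z)) q volume = eLpNorm u q volume from h2]
    rfl
  · have hs0 : s ≠ 0 := (zero_lt_one.trans_le hs).ne'
    rw [eLpNorm_eq_lintegral_rpow_of_ennreal hs0 hst, eLpNorm_eq_lintegral_rpow_of_ennreal hs0 hst]
    have hr : 0 < s.toReal := ENNReal.toReal_pos hs0 hst
    simp only [ENNReal.mul_rpow_of_nonneg _ _ hr.le]
    rw [lintegral_mul_const _ (hw.pow_const _), ENNReal.mul_rpow_of_nonneg _ _ (by positivity),
      ← ENNReal.rpow_mul, mul_one_div_cancel hr.ne', ENNReal.rpow_one]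

end WeightedNorm

/-! ### Mixed norms of the amplitude on dyadic shells -/

section AmplitudeNorm

variable {n : ℕ}

local notation "E" => EuclideanSpace ℝ (Fin n)

theorem bracket_rpow_le_of_mem_shell {k : ℕ} {ξ : E} (hξ : ξ ∈ shell n k) (μ : ℝ) :
    bracket ξ ^ μ ≤ 4 ^ |μ| * (2 ^ k : ℝ) ^ μ := by
  have h0 : 0 < bracket ξ := zero_lt_one.trans_le (one_le_bracket ξ)
  rcases le_total 0 μ with h | h
  · rw [abs_of_nonneg h, ← Real.mul_rpow (by norm_num) (by positivity)]
    exact Real.rpow_le_rpow h0.le hξ.2 h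
  · have hk : (0 : ℝ) < 2 ^ k / 4 := by positivity
    calc bracket ξ ^ μ ≤ (2 ^ k / 4 : ℝ) ^ μ := by
          refine Real.rpow_le_rpow_of_nonpos hk ?_ h
          refine le_trans ?_ hξ.1
          have : (0 : ℝ) ≤ 2 ^ k := by positivity
          linarith
      _ = _ := by
          rw [abs_of_nonpos h, Real.div_rpow (by positivity) (by norm_num),
            Real.rpow_neg (by norm_num)]
          field_simp

/-- After Minkowski (`s ≤ p`) only the `L^s` norm over the shell of a quantity of size `2^{kμ}`
remains; the volume of the shell contributes `2^{kn/s}`. -/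
theorem exists_eLpNorm_shell_le (n : ℕ) {s : ℝ≥0∞} (hs : 1 ≤ s) (hst : s ≠ ⊤) (μ : ℝ) (C : ℝ≥0) :
    ∃ Z : ℝ≥0, ∀ (p : ℝ≥0∞) (F : EuclideanSpace ℝ (Fin n) → EuclideanSpace ℝ (Fin n) → ℂ),
      s ≤ p → Measurable (Function.uncurry F) →
      (∀ ξ, eLpNorm (fun x => F x ξ) p volume ≤ C * ENNReal.ofReal (bracket ξ ^ μ)) →
      ∀ k : ℕ, eLpNorm (fun x => eLpNorm ((shell n k).indicator (F x)) s volume) p volume ≤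
        Z * ENNReal.ofReal ((2 ^ k : ℝ) ^ (μ + n / s.toReal)) := by
  set V := volume (Metric.ball (0 : EuclideanSpace ℝ (Fin n)) 1) with hV
  have hVt : V ≠ ⊤ := measure_ball_lt_top.ne
  have hs0 : s ≠ 0 := (zero_lt_one.trans_le hs).ne'
  have hr : 0 < s.toReal := ENNReal.toReal_pos hs0 hst
  set r := s.toReal with hrdef
  set Z : ℝ≥0∞ := C * ENNReal.ofReal (4 ^ |μ| * (4 ^ n : ℝ) ^ (1 / r)) * V ^ (1 / r) with hZ
  have hZt : Z ≠ ⊤ := ENNReal.mul_ne_top (ENNReal.mul_ne_top (by simp) (by simp))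
    (ENNReal.rpow_ne_top_of_nonneg (by positivity) hVt)
  refine ⟨Z.toNNReal, fun p F hp hF hb k => ?_⟩
  have hS := (isClosed_shell (n := n) k).measurableSet
  set c : ℝ≥0∞ := C * ENNReal.ofReal (4 ^ |μ| * (2 ^ k : ℝ) ^ μ) with hc
  have h1 := eLpNorm_eLpNorm_le (μ := volume) (ν := volume) (s := s) (p := p)
    (F := fun x ξ => (shell n k).indicator (fun ξ => ‖F x ξ‖ₑ) ξ)
    (g := (shell n k).indicator fun _ => c) ?_ hs hst hp (fun ξ => ?_)
    (measurable_const.indicator hS)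
  · have e : (fun x => eLpNorm ((shell n k).indicator (F x)) s volume) =
        fun x => eLpNorm (fun ξ => (shell n k).indicator (fun ξ => ‖F x ξ‖ₑ) ξ) s volume := by
      ext x
      refine eLpNorm_congr_enorm_ae (Filter.Eventually.of_forall fun ξ => ?_)
      rw [enorm_indicator_eq_indicator_enorm, enorm_eq_self]
    rw [e]
    refine h1.trans ?_
    rw [eLpNorm_indicator_const hS hs0 hst, enorm_eq_self, ENNReal.coe_toNNReal hZt]
    calc c * volume (shell n k) ^ (1 / s.toReal)
        ≤ c * (ENNReal.ofReal ((4 * 2 ^ k) ^ n) * V) ^ (1 / r) := by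
          gcongr; exact volume_shell_le n k
      _ = C * (ENNReal.ofReal (4 ^ |μ| * (2 ^ k : ℝ) ^ μ) *
            ENNReal.ofReal (((4 * 2 ^ k) ^ n : ℝ) ^ (1 / r))) * V ^ (1 / r) := by
          rw [ENNReal.mul_rpow_of_nonneg _ _ (by positivity),
            ENNReal.ofReal_rpow_of_nonneg (by positivity) (by positivity), hc]
          ring
      _ = C * (ENNReal.ofReal (4 ^ |μ| * (4 ^ n : ℝ) ^ (1 / r)) *
            ENNReal.ofReal ((2 ^ k : ℝ) ^ (μ + n / r))) * V ^ (1 / r) := by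
          rw [← ENNReal.ofReal_mul (by positivity), ← ENNReal.ofReal_mul (by positivity)]
          congr 3
          have : ((2 ^ k : ℝ) ^ n) ^ (1 / r) = (2 ^ k : ℝ) ^ (n / r) := by
            rw [← Real.rpow_natCast (2 ^ k : ℝ) n, ← Real.rpow_mul (by positivity)]
            congr 1; ring
          rw [mul_pow, Real.mul_rpow (by positivity) (by positivity), this,
            Real.rpow_add (by positivity)]
          ring
      _ = _ := by rw [hZ]; ring
  · exact (hF.enorm.indicator (measurable_snd hS) : Measurable
      ((Prod.snd ⁻¹' (shell n k)).indicator fun z : EuclideanSpace ℝ (Fin n) ×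
        EuclideanSpace ℝ (Fin n) => ‖Function.uncurry F z‖ₑ))
  · by_cases hξ : ξ ∈ shell n k
    · simp only [Set.indicator_of_mem hξ, eLpNorm_enorm]
      refine (hb ξ).trans ?_
      rw [hc]
      gcongr
      exact bracket_rpow_le_of_mem_shell hξ μ
    · simp [Set.indicator_of_notMem hξ]

/-- The quantity controlling the kernel of the `k`-th Littlewood-Paley piece of the symbol `b`. -/
def symbolNorm (s : ℝ≥0∞) (c : ℕ → ℝ≥0) (L k : ℕ) (t : ℝ) (b : EuclideanSpace ℝ (Fin n) → ℂ) :
    ℝ≥0∞ :=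
  (2 : ℝ≥0) * eLpNorm ((shell n k).indicator b) s volume +
    ∑ i, ∑ j ∈ Finset.range (L + 1), (L.choose j * c (L - j) : ℝ≥0) * (ENNReal.ofReal (t ^ j) *
      eLpNorm ((shell n k).indicator ((partialDeriv i)^[j] b)) s volume)

theorem eLpNorm_mul_cutoff_le (s : ℝ≥0∞) (k : ℕ) (b : E → ℂ) :
    eLpNorm (fun ξ => b ξ * cutoff k ξ) s volume ≤
      (2 : ℝ≥0) * eLpNorm ((shell n k).indicator b) s volume := by
  refine eLpNorm_le_nnreal_smul_eLpNorm_of_ae_le_mul' (Filter.Eventually.of_forall fun ξ => ?_) s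
  by_cases hξ : ξ ∈ shell n k
  · rw [Set.indicator_of_mem hξ, enorm_mul, mul_comm]
    gcongr
    rw [← ofReal_norm]
    refine ENNReal.ofReal_le_of_le_toReal ?_
    have : ‖cutoff k ξ‖ ≤ 2 := by
      cases k with
      | zero => exact (norm_dilatedBump_le 0 ξ).trans one_le_two
      | succ k =>
        refine (norm_sub_le _ _).trans ?_
        linarith [norm_dilatedBump_le (k + 1) ξ, norm_dilatedBump_le k ξ]
    simpa using this
  · rw [cutoff_eq_zero hξ]; simp

theorem measurable_eLpNorm_shell {s : ℝ≥0∞} (hs0 : s ≠ 0) (hst : s ≠ ⊤) (k : ℕ) {F : E → E → ℂ}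
    (hF : Measurable (Function.uncurry F)) :
    Measurable fun x => eLpNorm ((shell n k).indicator (F x)) s volume := by
  have e : (fun x => eLpNorm ((shell n k).indicator (F x)) s volume) =
      fun x => eLpNorm (fun ξ => (shell n k).indicator (fun ξ => ‖F x ξ‖ₑ) ξ) s volume := by
    ext x
    refine eLpNorm_congr_enorm_ae (Filter.Eventually.of_forall fun ξ => ?_)
    rw [enorm_indicator_eq_indicator_enorm, enorm_eq_self]
  rw [e]
  refine measurable_eLpNorm_prod_right ?_ hs0 hst
  exact (hF.enorm.indicator (measurable_snd (isClosed_shell (n := n) k).measurableSet) :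
    Measurable ((Prod.snd ⁻¹' (shell n k)).indicator fun z : E × E => ‖Function.uncurry F z‖ₑ))

theorem measurable_symbolNorm {a : E → E → ℂ} (hs : ∀ x, ContDiff ℝ ∞ (a x))
    (hm : ∀ ξ, Measurable fun x => a x ξ) {s : ℝ≥0∞} (hs0 : s ≠ 0) (hst : s ≠ ⊤) (c : ℕ → ℝ≥0)
    (L k : ℕ) (t : ℝ) : Measurable fun x => symbolNorm s c L k t (a x) := by
  unfold symbolNorm
  refine ((measurable_eLpNorm_shell hs0 hst k (measurable_uncurry_of_smooth hs hm)).const_mul _).add ?_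
  refine Finset.measurable_fun_sum _ fun i _ => Finset.measurable_fun_sum _ fun j _ => ?_
  exact ((measurable_eLpNorm_shell hs0 hst k
    (measurable_uncurry_iterate_partialDeriv hs hm i j)).const_mul _).const_mul _

theorem exists_eLpNorm_symbolNorm_le {s p : ℝ≥0∞} (hs : 1 ≤ s) (hst : s ≠ ⊤) (hp : s ≤ p)
    (m ϱ : ℝ) (c : ℕ → ℝ≥0) (L : ℕ) (C : (Fin n → ℕ) → ℝ≥0) : ∃ D : ℝ≥0,
    ∀ a : EuclideanSpace ℝ (Fin n) → EuclideanSpace ℝ (Fin n) → ℂ, (∀ x, ContDiff ℝ ∞ (a x)) →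
      (∀ ξ, Measurable fun x => a x ξ) → (∀ α, order α ≤ L → DerivBound p m ϱ a α (C α)) →
      ∀ k : ℕ, eLpNorm (fun x => symbolNorm s c L k ((2 ^ k : ℝ) ^ ϱ) (a x)) p volume ≤
        D * ENNReal.ofReal ((2 ^ k : ℝ) ^ (m + n / s.toReal)) := by
  have hp1 := hs.trans hp
  have hs0 : s ≠ 0 := (zero_lt_one.trans_le hs).ne'
  obtain ⟨Z₀, hZ₀⟩ := exists_eLpNorm_shell_le n hs hst m (C 0)
  choose Z hZ using fun (i : Fin n) (j : ℕ) =>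
    exists_eLpNorm_shell_le n hs hst (m - ϱ * j) (C (Pi.single i j))
  refine ⟨2 * Z₀ + ∑ i, ∑ j ∈ Finset.range (L + 1), (L.choose j * c (L - j)) * Z i j,
    fun a has ham hab k => ?_⟩
  have hmul : ∀ (b : ℝ≥0) (f : E → ℝ≥0∞), eLpNorm (fun x => b * f x) p volume ≤
      b * eLpNorm f p volume := fun b f =>
    eLpNorm_le_nnreal_smul_eLpNorm_of_ae_le_mul' (Filter.Eventually.of_forall fun x => le_rfl) p
  have m0 := measurable_eLpNorm_shell hs0 hst k (measurable_uncurry_of_smooth has ham)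
  have mj := fun i j => measurable_eLpNorm_shell hs0 hst k (measurable_uncurry_iterate_partialDeriv has ham i j)
  have b0 : eLpNorm (fun x => eLpNorm ((shell n k).indicator (a x)) s volume) p volume ≤
      Z₀ * ENNReal.ofReal ((2 ^ k : ℝ) ^ (m + n / s.toReal)) := by
    refine hZ₀ p a hp (measurable_uncurry_of_smooth has ham) (fun ξ => ?_) k
    have := hab 0 (by simp [order]) ξ
    simpa [multiDeriv_zero, order] using this
  have bj : ∀ i, ∀ j ∈ Finset.range (L + 1), eLpNorm (fun x =>
      eLpNorm ((shell n k).indicator ((partialDeriv i)^[j] (a x))) s volume) p volume ≤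
      Z i j * ENNReal.ofReal ((2 ^ k : ℝ) ^ (m - ϱ * j + n / s.toReal)) := by
    intro i j hj
    have hjL : j ≤ L := by simpa [Nat.lt_succ_iff] using hj
    refine hZ i j p _ hp (measurable_uncurry_iterate_partialDeriv has ham i j) (fun ξ => ?_) k
    have := hab (Pi.single i j) (by rw [order_single]; exact hjL) ξ
    simpa only [multiDeriv_single, order_single] using this
  -- The choice `t = 2^{kϱ}` exactly cancels the gain from `j` derivatives, so all terms have the
  -- same size.
  have htj : ∀ j : ℕ, ENNReal.ofReal (((2 ^ k : ℝ) ^ ϱ) ^ j) *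
      ENNReal.ofReal ((2 ^ k : ℝ) ^ (m - ϱ * j + n / s.toReal)) =
      ENNReal.ofReal ((2 ^ k : ℝ) ^ (m + n / s.toReal)) := by
    intro j
    rw [← ENNReal.ofReal_mul (by positivity), ← Real.rpow_natCast, ← Real.rpow_mul (by positivity),
      ← Real.rpow_add (by positivity)]
    congr 2; ring
  set R := ENNReal.ofReal ((2 ^ k : ℝ) ^ (m + n / s.toReal)) with hR
  have e : (fun x => symbolNorm s c L k ((2 ^ k : ℝ) ^ ϱ) (a x)) =
      (fun x => (2 : ℝ≥0) * eLpNorm ((shell n k).indicator (a x)) s volume) +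
      ∑ i, ∑ j ∈ Finset.range (L + 1), fun x => ((L.choose j * c (L - j) : ℝ≥0) : ℝ≥0∞) *
        (ENNReal.ofReal (((2 ^ k : ℝ) ^ ϱ) ^ j) *
          eLpNorm ((shell n k).indicator ((partialDeriv i)^[j] (a x))) s volume) := by
    ext x
    simp [symbolNorm]
  have mjj : ∀ i j, Measurable fun x => ((L.choose j * c (L - j) : ℝ≥0) : ℝ≥0∞) *
      (ENNReal.ofReal (((2 ^ k : ℝ) ^ ϱ) ^ j) *
        eLpNorm ((shell n k).indicator ((partialDeriv i)^[j] (a x))) s volume) :=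
    fun i j => ((mj i j).const_mul _).const_mul _
  rw [e]
  refine (eLpNorm_add_le (m0.const_mul _).aestronglyMeasurable
    (Finset.aestronglyMeasurable_sum _ fun i _ => Finset.aestronglyMeasurable_sum _ fun j _ =>
      (mjj i j).aestronglyMeasurable) hp1).trans ?_
  push_cast
  rw [add_mul, Finset.sum_mul]
  refine add_le_add ?_ ((eLpNorm_sum_le (fun i _ => Finset.aestronglyMeasurable_sum _ fun j _ =>
      (mjj i j).aestronglyMeasurable) hp1).trans (Finset.sum_le_sum fun i _ => ?_))
  · refine (hmul 2 _).trans ?_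
    rw [mul_assoc]
    push_cast
    gcongr
  · rw [Finset.sum_mul]
    refine (eLpNorm_sum_le (fun j _ => (mjj i j).aestronglyMeasurable) hp1).trans
      (Finset.sum_le_sum fun j hj => ?_)
    refine (hmul _ _).trans ?_
    push_cast
    rw [mul_assoc (_ * _)]
    gcongr
    refine (hmul (Real.toNNReal (((2 ^ k : ℝ) ^ ϱ) ^ j)) _).trans ?_
    rw [← htj j]
    refine (mul_le_mul_right (bj i j hj) _).trans (le_of_eq ?_)
    simp only [ENNReal.ofReal]
    ring

end AmplitudeNorm

/-! ### Convergence of the operator, summation over dyadic pieces, and Hölder -/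

section Boundedness

variable {n : ℕ}

local notation "E" => EuclideanSpace ℝ (Fin n)

open scoped FourierTransform in
theorem exists_schwartz_eq_fourierHat (u : 𝓢(EuclideanSpace ℝ (Fin n), ℂ)) :
    ∃ v : 𝓢(EuclideanSpace ℝ (Fin n), ℂ), ∀ ξ, fourierHat u ξ = v ξ := by
  have h0 : (2 * Real.pi)⁻¹ ≠ 0 := by simp [Real.pi_ne_zero]
  let A : E ≃L[ℝ] E := ContinuousLinearEquiv.smulLeft (Units.mk0 (2 * Real.pi)⁻¹ h0)
  refine ⟨SchwartzMap.compCLMOfContinuousLinearEquiv ℂ A (𝓕 u), fun ξ => ?_⟩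
  have h1 : fourierHat u ξ = oscInt u (-ξ) := by
    rw [fourierHat, oscInt]
    congr 1; ext y
    rw [inner_neg_left, real_inner_comm]
    push_cast
    ring_nf
  rw [h1, oscInt_eq_fourier]
  simp only [SchwartzMap.compCLMOfContinuousLinearEquiv_apply, Function.comp_apply,
    SchwartzMap.fourier_coe]
  have hA : A ξ = ((2 * Real.pi)⁻¹ : ℝ) • ξ := rfl
  rw [hA, neg_smul, smul_neg, neg_neg]

theorem lintegral_bracket_rpow_mul_lt_top (v : 𝓢(EuclideanSpace ℝ (Fin n), ℂ)) (m : ℝ) :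
    ∫⁻ ξ, ENNReal.ofReal (bracket ξ ^ m) * ‖v ξ‖ₑ < ⊤ := by
  obtain ⟨M, hM⟩ := exists_nat_ge m
  have hint : Integrable fun ξ : E => 2 ^ M * (‖ξ‖ ^ 0 * ‖v ξ‖ + ‖ξ‖ ^ M * ‖v ξ‖) :=
    ((v.integrable_pow_mul volume 0).add (v.integrable_pow_mul volume M)).const_mul _
  refine lt_of_le_of_lt (lintegral_mono fun ξ => ?_) hint.2
  rw [← ofReal_norm (v ξ), ← ENNReal.ofReal_mul (Real.rpow_nonneg (zero_le_one.trans
    (one_le_bracket ξ)) _), Real.enorm_eq_ofReal (by positivity)]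
  refine ENNReal.ofReal_le_ofReal ?_
  have h1 : bracket ξ ^ m ≤ (1 + ‖ξ‖) ^ M := by
    calc bracket ξ ^ m ≤ bracket ξ ^ (M : ℝ) :=
          Real.rpow_le_rpow_of_exponent_le (one_le_bracket ξ) hM
      _ = bracket ξ ^ M := Real.rpow_natCast _ _
      _ ≤ _ := pow_le_pow_left₀ (zero_le_one.trans (one_le_bracket ξ))
          (bracket_le_one_add_norm ξ) M
  have h2 : (1 + ‖ξ‖) ^ M ≤ 2 ^ M * (1 + ‖ξ‖ ^ M) := by
    rcases le_total ‖ξ‖ 1 with h | h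
    · calc (1 + ‖ξ‖) ^ M ≤ 2 ^ M := pow_le_pow_left₀ (by positivity) (by linarith) M
        _ ≤ _ := le_mul_of_one_le_right (by positivity) (by linarith [pow_nonneg (norm_nonneg ξ) M])
    · calc (1 + ‖ξ‖) ^ M ≤ (2 * ‖ξ‖) ^ M := pow_le_pow_left₀ (by positivity) (by linarith) M
        _ = 2 ^ M * ‖ξ‖ ^ M := mul_pow _ _ _
        _ ≤ _ := by gcongr; linarith
  calc bracket ξ ^ m * ‖v ξ‖ ≤ 2 ^ M * (1 + ‖ξ‖ ^ M) * ‖v ξ‖ := by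
        gcongr; exact h1.trans h2
    _ = _ := by ring

/-- Minkowski bounds the `L^p` norm of `x ↦ ∫ |a(x,ξ)| |û(ξ)| dξ` by `∫ ⟨ξ⟩^m |û(ξ)| dξ` up to a
constant. This is finite by rapid decay, so the inner integral is finite almost everywhere. -/
theorem ae_integrable_fioIntegrand {a : E → E → ℂ} (has : ∀ x, ContDiff ℝ ∞ (a x))
    (ham : ∀ ξ, Measurable fun x => a x ξ) {p : ℝ≥0∞} (hp : 1 ≤ p) {m ϱ : ℝ} {C : ℝ≥0}
    (hab : DerivBound p m ϱ a 0 C) (u : 𝓢(EuclideanSpace ℝ (Fin n), ℂ)) :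
    ∀ᵐ x, Integrable (fioIntegrand (fun x ξ => inner ℝ x ξ) a u x) volume := by
  obtain ⟨v, hv⟩ := exists_schwartz_eq_fourierHat u
  have haj := measurable_uncurry_of_smooth has ham
  have hF : Measurable (Function.uncurry fun x ξ => ‖a x ξ‖ₑ * ‖v ξ‖ₑ) :=
    haj.enorm.mul (v.continuous.measurable.comp measurable_snd).enorm
  have hg : Measurable fun ξ : E => C * (ENNReal.ofReal (bracket ξ ^ m) * ‖v ξ‖ₑ) :=
    (((continuous_bracket.measurable.pow_const m).ennreal_ofReal).mul
      v.continuous.measurable.enorm).const_mul _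
  have h1 := eLpNorm_lintegral_le (μ := volume) (ν := volume) hF hp
    (Filter.Eventually.of_forall fun ξ => ?_) hg
  · have h2 : ∫⁻ ξ, C * (ENNReal.ofReal (bracket ξ ^ m) * ‖v ξ‖ₑ) < ⊤ := by
      rw [lintegral_const_mul' _ _ (by simp)]
      exact ENNReal.mul_lt_top (by simp) (lintegral_bracket_rpow_mul_lt_top v m)
    filter_upwards [ae_lt_top_of_eLpNorm_lt_top hF.lintegral_prod_right'
      (zero_lt_one.trans_le hp).ne' (h1.trans_lt h2)] with x hx
    refine ⟨?_, ?_⟩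
    · refine Continuous.aestronglyMeasurable ?_
      have h3 : Continuous (fourierHat u) := (funext hv : fourierHat u = v) ▸ v.continuous
      have h4 := (has x).continuous
      unfold fioIntegrand
      fun_prop
    · refine lt_of_le_of_lt (lintegral_mono fun ξ => ?_) hx
      rw [fioIntegrand, enorm_mul, enorm_mul, enorm_exp_I_mul, one_mul, hv]
      rfl
  · have h2 := eLpNorm_le_nnreal_smul_eLpNorm_of_ae_le_mul' (μ := volume)
      (f := fun x => ‖a x ξ‖ₑ * ‖v ξ‖ₑ) (g := fun x => a x ξ) (c := ‖v ξ‖₊)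
      (Filter.Eventually.of_forall fun x => by rw [enorm_eq_self, mul_comm]; rfl) p
    have h3 := hab ξ
    simp only [multiDeriv_zero, order, Pi.zero_apply, Finset.sum_const_zero, Nat.cast_zero,
      mul_zero, sub_zero] at h3
    calc _ ≤ ‖v ξ‖ₑ * eLpNorm (fun x => a x ξ) p volume := h2
      _ ≤ ‖v ξ‖ₑ * (C * ENNReal.ofReal (bracket ξ ^ m)) := by gcongr
      _ = _ := by ring

theorem stronglyMeasurable_fio {a : E → E → ℂ} (has : ∀ x, ContDiff ℝ ∞ (a x))
    (ham : ∀ ξ, Measurable fun x => a x ξ) (u : 𝓢(EuclideanSpace ℝ (Fin n), ℂ)) :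
    StronglyMeasurable (fio (fun x ξ => inner ℝ x ξ) a u) := by
  obtain ⟨v, hv⟩ := exists_schwartz_eq_fourierHat u
  have haj := measurable_uncurry_of_smooth has ham
  have h1 : StronglyMeasurable (Function.uncurry (fioIntegrand (fun x ξ => inner ℝ x ξ) a u)) := by
    refine Measurable.stronglyMeasurable ?_
    have e : Function.uncurry (fioIntegrand (fun x ξ => inner ℝ x ξ) a u) = fun z : E × E =>
        Complex.exp (Complex.I * ((inner ℝ z.1 z.2 : ℝ) : ℂ)) * Function.uncurry a z * v z.2 := by
      ext z
      simp only [Function.uncurry, fioIntegrand, hv]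
    rw [e]
    refine Measurable.mul (Measurable.mul ?_ haj) (v.continuous.measurable.comp measurable_snd)
    refine Continuous.measurable ?_
    fun_prop
  exact (h1.integral_prod_right (ν := volume)).const_mul _

theorem enorm_one_div_two_pi_pow_le (n : ℕ) : ‖(1 / (2 * (Real.pi : ℂ)) ^ n : ℂ)‖ₑ ≤ 1 := by
  rw [← ofReal_norm, ENNReal.ofReal_le_one, norm_div, norm_one, norm_pow, norm_mul,
    Complex.norm_real, Complex.norm_ofNat, Real.norm_of_nonneg Real.pi_pos.le]
  refine div_le_one_of_le₀ (one_le_pow₀ ?_) (by positivity)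
  linarith [Real.pi_gt_three]

/-- Pointwise control of the operator by its Littlewood-Paley pieces. -/
theorem enorm_fio_le_tsum {a : E → E → ℂ}
    (u : 𝓢(EuclideanSpace ℝ (Fin n), ℂ)) {x : E}
    (hx : Integrable (fioIntegrand (fun x ξ => inner ℝ x ξ) a u x) volume) :
    ‖fio (fun x ξ => inner ℝ x ξ) a u x‖ₑ ≤ ∑' k, ‖∫ ξ,
      Complex.exp (Complex.I * ((inner ℝ x ξ : ℝ) : ℂ)) * (a x ξ * cutoff k ξ) *
        fourierHat u ξ‖ₑ := by
  set f := fioIntegrand (fun x ξ => inner ℝ x ξ) a u x with hf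
  have hfk : ∀ k, Integrable fun ξ => cutoff k ξ * f ξ := by
    intro k
    refine hx.bdd_mul (c := 2) (contDiff_cutoff k).continuous.aestronglyMeasurable
      (Filter.Eventually.of_forall fun ξ => ?_)
    cases k with
    | zero => exact (norm_dilatedBump_le 0 ξ).trans one_le_two
    | succ k =>
      refine (norm_sub_le _ _).trans ?_
      linarith [norm_dilatedBump_le (k + 1) ξ, norm_dilatedBump_le k ξ]
  -- The partial sums of the cutoffs telescope to a single bump, bounded by `1` and tending to `1`,
  -- so dominated convergence applies.
  have hlim : Filter.Tendsto (fun K => ∑ k ∈ Finset.range K, ∫ ξ, cutoff k ξ * f ξ) Filter.atTop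
      (nhds (∫ ξ, f ξ)) := by
    have e : (fun K => ∑ k ∈ Finset.range K, ∫ ξ, cutoff k ξ * f ξ) =
        fun K => ∫ ξ, (∑ k ∈ Finset.range K, cutoff k ξ) * f ξ := by
      ext K
      rw [← integral_finsetSum _ fun k _ => hfk k]
      simp only [Finset.sum_mul]
    rw [e]
    refine tendsto_integral_of_dominated_convergence (fun ξ => ‖f ξ‖) (fun K => ?_) hx.norm
      (fun K => Filter.Eventually.of_forall fun ξ => ?_)
      (Filter.Eventually.of_forall fun ξ => ?_)
    · simp only [Finset.sum_mul]
      exact (integrable_finsetSum _ fun k _ => hfk k).aestronglyMeasurable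
    · rw [norm_mul]
      exact mul_le_of_le_one_left (norm_nonneg _) (norm_sum_cutoff_le K ξ)
    · simpa using (tendsto_sum_cutoff ξ).mul_const (f ξ)
  have e2 : ∀ k, ∫ ξ, Complex.exp (Complex.I * ((inner ℝ x ξ : ℝ) : ℂ)) *
      (a x ξ * cutoff k ξ) * fourierHat u ξ = ∫ ξ, cutoff k ξ * f ξ := by
    intro k
    congr 1; ext ξ
    rw [hf, fioIntegrand]; ring
  simp only [e2]
  calc ‖fio (fun x ξ => inner ℝ x ξ) a u x‖ₑ ≤ 1 * ‖∫ ξ, f ξ‖ₑ := by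
        rw [fio, enorm_mul]; gcongr; exact enorm_one_div_two_pi_pow_le n
    _ = ‖∫ ξ, f ξ‖ₑ := one_mul _
    _ ≤ _ := by
        refine le_of_tendsto hlim.enorm (Filter.Eventually.of_forall fun K => ?_)
        exact (enorm_sum_le _ _).trans (ENNReal.sum_le_tsum _)

/-- Separating the factors allows summation in `L^p` and `L^q`, where the triangle inequality holds
even if it fails in `L^r`. -/
theorem tsum_mul_le_tsum_mul_tsum (f g : ℕ → ℝ≥0∞) :
    ∑' k, f k * g k ≤ (∑' k, f k) * ∑' k, g k := by
  rw [← ENNReal.tsum_mul_right]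
  exact ENNReal.tsum_le_tsum fun k => by gcongr; exact ENNReal.le_tsum k

theorem tsum_ofReal_two_pow_rpow_lt_top {δ : ℝ} (hδ : 0 < δ) :
    ∑' k : ℕ, ENNReal.ofReal ((2 ^ k : ℝ) ^ (-δ)) < ⊤ := by
  have e : ∀ k : ℕ, ENNReal.ofReal ((2 ^ k : ℝ) ^ (-δ)) = ENNReal.ofReal (2 ^ (-δ)) ^ k := by
    intro k
    rw [← ENNReal.ofReal_pow (by positivity), ← Real.rpow_natCast, ← Real.rpow_natCast,
      ← Real.rpow_mul (by norm_num), ← Real.rpow_mul (by norm_num)]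
    congr 2; ring
  simp only [e]
  rw [ENNReal.tsum_geometric, ENNReal.inv_lt_top, tsub_pos_iff_lt, ENNReal.ofReal_lt_one]
  exact Real.rpow_lt_one_of_one_lt_of_neg one_lt_two (by linarith)

/-- Finite norms make `A` and `B` finite almost everywhere, so Hölder for real functions applies. -/
theorem eLpNorm_le_of_enorm_le_mul {f : E → ℂ} {A B : E → ℝ≥0∞} (hA : Measurable A)
    (hB : Measurable B) {p q r : ℝ≥0∞} (hp : p ≠ 0) (hq : q ≠ 0) [hpqr : p.HolderTriple q r]
    (hAp : eLpNorm A p volume < ⊤) (hBq : eLpNorm B q volume < ⊤)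
    (hf : ∀ᵐ x, ‖f x‖ₑ ≤ A x * B x) :
    eLpNorm f r volume ≤ eLpNorm A p volume * eLpNorm B q volume := by
  have key : ∀ {G : E → ℝ≥0∞} {s : ℝ≥0∞}, (∀ᵐ x, G x < ⊤) →
      eLpNorm G s volume = eLpNorm (fun x => (G x).toReal) s volume := by
    intro G s hG
    refine eLpNorm_congr_enorm_ae ?_
    filter_upwards [hG] with x hx
    rw [Real.enorm_eq_ofReal ENNReal.toReal_nonneg, ENNReal.ofReal_toReal hx.ne, enorm_eq_self]
  have hA' := ae_lt_top_of_eLpNorm_lt_top hA hp hAp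
  have hB' := ae_lt_top_of_eLpNorm_lt_top hB hq hBq
  rw [key hA', key hB']
  refine le_trans (eLpNorm_mono_enorm_ae ?_) (eLpNorm_smul_le_mul_eLpNorm (r := r)
    hB.ennreal_toReal.aestronglyMeasurable hA.ennreal_toReal.aestronglyMeasurable)
  filter_upwards [hA', hB', hf] with x h1 h2 h3
  simp only [Pi.smul_apply', smul_eq_mul, enorm_mul]
  rwa [Real.enorm_eq_ofReal ENNReal.toReal_nonneg, ENNReal.ofReal_toReal h1.ne,
    Real.enorm_eq_ofReal ENNReal.toReal_nonneg, ENNReal.ofReal_toReal h2.ne]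

theorem exists_boundedWithNorm_of_smooth (n : ℕ) {m ϱ : ℝ} {p q r s : ℝ≥0∞} (hs1 : 1 ≤ s)
    (hs2 : s ≤ 2) (hsp : s ≤ p) (hsq : s ≤ q) (hpqr : p.HolderTriple q r) (hϱ1 : ϱ ≤ 1)
    (hm : m < (n : ℝ) * (ϱ - 1) / s.toReal) (C : (Fin n → ℕ) → ℝ≥0) : ∃ K : ℝ≥0,
      ∀ a : EuclideanSpace ℝ (Fin n) → EuclideanSpace ℝ (Fin n) → ℂ,
        (∀ x, ContDiff ℝ ∞ (a x)) → (∀ ξ, Measurable fun x => a x ξ) →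
        (∀ α, order α ≤ n + 1 → DerivBound p m ϱ a α (C α)) →
        BoundedWithNorm q r (fun x ξ => inner ℝ x ξ) a K := by
  have hst : s ≠ ⊤ := (hs2.trans_lt (by norm_num)).ne
  have hs0 : s ≠ 0 := (zero_lt_one.trans_le hs1).ne'
  have hp1 := hs1.trans hsp
  have hq1 := hs1.trans hsq
  set s' : ℝ≥0∞ := (1 - s⁻¹)⁻¹ with hs'def
  have hss : s.HolderConjugate s' := by
    rw [ENNReal.holderConjugate_iff, hs'def, inv_inv]
    exact add_tsub_cancel_of_le (ENNReal.inv_le_one.2 hs1)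
  have hs'1 : 1 ≤ s' := by
    rw [hs'def, ENNReal.one_le_inv]; exact tsub_le_self
  obtain ⟨H, hH⟩ := exists_eLpNorm_oscInt_le n hss hs1 hs2
  obtain ⟨c, hc⟩ := exists_norm_iterate_partialDeriv_cutoff_le n
  obtain ⟨D, hD⟩ := exists_eLpNorm_symbolNorm_le hs1 hst hsp m ϱ c (n + 1) C
  set σ := s.toReal with hσ
  -- Half of the gap in the hypothesis on `m`: the decay `2^{-2δk}` of the product is shared equally
  -- by the two factors.
  set δ : ℝ := ((n : ℝ) * (ϱ - 1) / σ - m) / 2 with hδdef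
  have hδ : 0 < δ := by rw [hδdef]; linarith
  set W := eLpNorm (fun z : EuclideanSpace ℝ (Fin n) => (weight 1 (n + 1) z)⁻¹) s volume with hW
  have hWt : W < ⊤ := eLpNorm_inv_weight_lt_top hs1 hst
  set Sδ : ℝ≥0∞ := ∑' k : ℕ, ENNReal.ofReal ((2 ^ k : ℝ) ^ (-δ)) with hS
  have hSt : Sδ < ⊤ := tsum_ofReal_two_pow_rpow_lt_top hδ
  set K : ℝ≥0∞ := (H * D * Sδ) * (W * Sδ) with hK
  have hKt : K ≠ ⊤ := (ENNReal.mul_lt_top (ENNReal.mul_lt_top (by simp [ENNReal.mul_lt_top_iff])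
    hSt) (ENNReal.mul_lt_top hWt hSt)).ne
  refine ⟨K.toNNReal, fun a has ham hab u => ?_⟩
  have hint := ae_integrable_fioIntegrand has ham hp1 (hab 0 (by simp [order])) u
  refine ⟨hint, (stronglyMeasurable_fio has ham u).aestronglyMeasurable, ?_⟩
  let t : ℕ → ℝ := fun k => (2 ^ k : ℝ) ^ ϱ
  have ht0 : ∀ k, 0 < t k := fun k => by positivity
  have ht : ∀ k, t k ≤ 2 ^ k := fun k =>
    (Real.rpow_le_rpow_of_exponent_le (one_le_pow₀ one_le_two) hϱ1).trans (Real.rpow_one _).le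
  let A : ℕ → EuclideanSpace ℝ (Fin n) → ℝ≥0∞ := fun k x =>
    H * symbolNorm s c (n + 1) k (t k) (a x)
  let B : ℕ → EuclideanSpace ℝ (Fin n) → ℝ≥0∞ := fun k x =>
    eLpNorm (fun z => ENNReal.ofReal (weight (t k) (n + 1) z)⁻¹ * ‖u (x - z)‖ₑ) s volume
  -- Chosen so that `α_k A_k` has size `2^{-kδ}` in `L^p`; then `α_k⁻¹ B_k` also has size `2^{-kδ}`
  -- in `L^q`, relative to `‖u‖_q`.
  let α : ℕ → ℝ := fun k => (2 ^ k : ℝ) ^ (-(m + n / σ) - δ)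
  have hα : ∀ k, 0 < α k := fun k => by positivity
  have hAm : ∀ k, Measurable (A k) := fun k =>
    (measurable_symbolNorm has ham hs0 hst c (n + 1) k (t k)).const_mul _
  have hBm : ∀ k, Measurable (B k) := by
    intro k
    refine measurable_eLpNorm_prod_right ?_ hs0 hst
    have hw : Measurable fun z : EuclideanSpace ℝ (Fin n) =>
      ENNReal.ofReal (weight (t k) (n + 1) z)⁻¹ :=
      (continuous_weight (t k) (n + 1)).measurable.inv.ennreal_ofReal
    refine (hw.comp measurable_snd).mul ?_
    have : Continuous fun z : EuclideanSpace ℝ (Fin n) × EuclideanSpace ℝ (Fin n) =>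
      u (z.1 - z.2) := by fun_prop
    exact this.measurable.enorm
  have hmul : ∀ (b : ℝ≥0) (f : EuclideanSpace ℝ (Fin n) → ℝ≥0∞) (p : ℝ≥0∞),
      eLpNorm (fun x => b * f x) p volume ≤ b * eLpNorm f p volume := fun b f p =>
    eLpNorm_le_nnreal_smul_eLpNorm_of_ae_le_mul' (Filter.Eventually.of_forall fun x => le_rfl) p
  have hAn : ∀ k, eLpNorm (fun x => ENNReal.ofReal (α k) * A k x) p volume ≤
      H * D * ENNReal.ofReal ((2 ^ k : ℝ) ^ (-δ)) := by
    intro k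
    refine (hmul (α k).toNNReal _ _).trans ((mul_le_mul_right ((hmul H _ _).trans
      (mul_le_mul_right (hD a has ham hab k) _)) _).trans (le_of_eq ?_))
    have : ENNReal.ofReal ((2 ^ k : ℝ) ^ (-δ)) =
        ENNReal.ofReal (α k) * ENNReal.ofReal ((2 ^ k : ℝ) ^ (m + n / σ)) := by
      rw [← ENNReal.ofReal_mul (hα k).le, ← Real.rpow_add (by positivity)]
      congr 2; ring
    rw [this]
    simp only [ENNReal.ofReal]
    ring
  have hBn : ∀ k, eLpNorm (fun x => ENNReal.ofReal (α k)⁻¹ * B k x) q volume ≤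
      W * eLpNorm u q volume * ENNReal.ofReal ((2 ^ k : ℝ) ^ (-δ)) := by
    intro k
    refine (hmul (α k)⁻¹.toNNReal _ _).trans ((mul_le_mul_right
      (eLpNorm_convolution_weight_le hs1 hst hsq (t k) (n + 1) u.continuous) _).trans
      (le_of_eq ?_))
    rw [eLpNorm_inv_weight hst (ht0 k)]
    have : ENNReal.ofReal ((2 ^ k : ℝ) ^ (-δ)) =
        ENNReal.ofReal (α k)⁻¹ * ENNReal.ofReal (t k ^ (-(n / σ))) := by
      rw [← ENNReal.ofReal_mul (inv_nonneg.2 (hα k).le), ← Real.rpow_neg (by positivity),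
        ← Real.rpow_mul (by positivity), ← Real.rpow_add (by positivity)]
      congr 2
      rw [hδdef]; ring
    rw [this]
    simp only [ENNReal.ofReal]
    ring
  have hA : eLpNorm (fun x => ∑' k, ENNReal.ofReal (α k) * A k x) p volume ≤ H * D * Sδ := by
    refine (eLpNorm_tsum_ennreal_le (fun k => (hAm k).const_mul _) hp1).trans ?_
    rw [hS, ← ENNReal.tsum_mul_left]
    exact ENNReal.tsum_le_tsum hAn
  have hB : eLpNorm (fun x => ∑' k, ENNReal.ofReal (α k)⁻¹ * B k x) q volume ≤
      W * eLpNorm u q volume * Sδ := by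
    refine (eLpNorm_tsum_ennreal_le (fun k => (hBm k).const_mul _) hq1).trans ?_
    rw [hS, ← ENNReal.tsum_mul_left]
    exact ENNReal.tsum_le_tsum hBn
  have hAt : H * D * Sδ < ⊤ := ENNReal.mul_lt_top (by simp [ENNReal.mul_lt_top_iff]) hSt
  have hBt : W * eLpNorm u q volume * Sδ < ⊤ :=
    ENNReal.mul_lt_top (ENNReal.mul_lt_top hWt (u.memLp q volume).2) hSt
  have hpt : ∀ᵐ x, ‖fio (fun x ξ => inner ℝ x ξ) a u x‖ₑ ≤
      (∑' k, ENNReal.ofReal (α k) * A k x) * ∑' k, ENNReal.ofReal (α k)⁻¹ * B k x := by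
    filter_upwards [hint] with x hx
    refine (enorm_fio_le_tsum u hx).trans (le_trans (ENNReal.tsum_le_tsum fun k => ?_)
      (tsum_mul_le_tsum_mul_tsum _ _))
    have h1 := enorm_integral_exp_mul_fourierHat_le hss hs'1 hH
      ((has x).mul (contDiff_cutoff k)) (hasCompactSupport_mul_cutoff (a x) k) (ht0 k).le (n + 1)
      u.continuous u.integrable x
    have h2 : H * (eLpNorm (fun ξ => a x ξ * cutoff k ξ) s volume +
        ∑ i, ENNReal.ofReal (t k ^ (n + 1)) *
          eLpNorm ((partialDeriv i)^[n + 1] fun ξ => a x ξ * cutoff k ξ) s volume) ≤ A k x := by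
      simp only [A, symbolNorm]
      gcongr with i
      · exact eLpNorm_mul_cutoff_le s k (a x)
      · exact eLpNorm_iterate_partialDeriv_mul_cutoff_le hc (has x) hs1 (ht0 k) (ht k) i (n + 1)
    refine h1.trans ((mul_le_mul_left h2 _).trans (le_of_eq ?_))
    have h3 : ENNReal.ofReal (α k) * ENNReal.ofReal (α k)⁻¹ = 1 := by
      rw [← ENNReal.ofReal_mul (hα k).le, mul_inv_cancel₀ (hα k).ne', ENNReal.ofReal_one]
    calc A k x * B k x = (ENNReal.ofReal (α k) * ENNReal.ofReal (α k)⁻¹) * (A k x * B k x) := by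
          rw [h3, one_mul]
      _ = _ := by ring
  refine (eLpNorm_le_of_enorm_le_mul (p := p) (q := q)
    (Measurable.tsum fun k => (hAm k).const_mul _)
    (Measurable.tsum fun k => (hBm k).const_mul _) (zero_lt_one.trans_le hp1).ne'
    (zero_lt_one.trans_le hq1).ne' (hA.trans_lt hAt) (hB.trans_lt hBt) hpt).trans ?_
  refine (mul_le_mul' hA hB).trans (le_of_eq ?_)
  rw [ENNReal.coe_toNNReal hKt, hK]
  ring

end Boundedness

end RoughFIO

end

/-! ### The boundedness theorem for general amplitudes -/

theorem theorem4p3 (n : ℕ) (m ϱ : ℝ) (p q r : ℝ≥0∞)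
    (hr : 0 < r) (hp : 1 ≤ p) (hq : 1 ≤ q) (hpqr : 1 / r = 1 / q + 1 / p)
    (hϱ0 : 0 ≤ ϱ) (hϱ1 : ϱ ≤ 1)
    (hm : m < (n : ℝ) * (ϱ - 1) / (min 2 (min p q)).toReal) :
    ∃ N : ℕ, ∀ C : (Fin n → ℕ) → ℝ≥0, ∃ K : ℝ≥0,
      ∀ a : EuclideanSpace ℝ (Fin n) → EuclideanSpace ℝ (Fin n) → ℂ,
        RoughFIO.IsAmplitude p m ϱ a →
        (∀ α : Fin n → ℕ, RoughFIO.order α ≤ N → RoughFIO.DerivBound p m ϱ a α (C α)) →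
        RoughFIO.BoundedWithNorm q r (fun x ξ => inner ℝ x ξ) a K := by
  have hH : p.HolderTriple q r := ⟨by simpa [add_comm] using hpqr.symm⟩
  -- The order of derivatives needed is the exponent `n + 1` of the weight.
  refine ⟨n + 1, fun C => ?_⟩
  obtain ⟨K, hK⟩ := RoughFIO.exists_boundedWithNorm_of_smooth n (s := min 2 (min p q))
    (le_min one_le_two (le_min hp hq)) (min_le_left _ _)
    ((min_le_right _ _).trans (min_le_left _ _)) ((min_le_right _ _).trans (min_le_right _ _))
    hH hϱ1 hm C
  refine ⟨K, fun a ha hab u => ?_⟩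
  -- Changing the amplitude for a null set of `x` alters neither the derivative bounds nor, almost
  -- everywhere, the integrand and the operator.
  obtain ⟨b, hbs, hbm, hbae⟩ :=
    RoughFIO.exists_measurable_smooth_modification ha.measurable ha.smooth
  have hbb : ∀ α, RoughFIO.order α ≤ n + 1 → RoughFIO.DerivBound p m ϱ b α (C α) := by
    intro α hα ξ
    refine le_of_eq_of_le (eLpNorm_congr_ae ?_) (hab α hα ξ)
    filter_upwards [hbae] with x hx
    rw [hx]
  obtain ⟨h1, h2, h3⟩ := hK b hbs hbm hbb u
  have hI : ∀ᵐ x, RoughFIO.fioIntegrand (fun x ξ => inner ℝ x ξ) b u x =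
      RoughFIO.fioIntegrand (fun x ξ => inner ℝ x ξ) a u x := by
    filter_upwards [hbae] with x hx
    ext ξ
    simp only [RoughFIO.fioIntegrand, hx]
  have hT : RoughFIO.fio (fun x ξ => inner ℝ x ξ) b u =ᵐ[volume]
      RoughFIO.fio (fun x ξ => inner ℝ x ξ) a u := by
    filter_upwards [hI] with x hx
    simp only [RoughFIO.fio, hx]
  refine ⟨?_, h2.congr hT, ?_⟩
  · filter_upwards [h1, hI] with x hx1 hx2
    rwa [← hx2]
  · rwa [← eLpNorm_congr_ae hT]
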